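/- **Setting.** Let $\mathbb X$ be the kinematic state space with reference measure $dx$, $\mathbb L$ the (discrete) label space at time $k-1$, and $\mathbb B$ a finite set of birth labels, disjoint from $\mathbb L$. For a finite set $\mathbf X$ of labeled states $(x,\ell)$ let $\mathcal L(\mathbf X)$ be its set of labels; $\Delta(\mathbf X)=1$ if the labels in $\mathbf X$ are distinct and $0$ otherwise; $\delta_I(J)=1$ if $I=J$ and $0$ otherwise; $h^{\mathbf X}=\prod_{\mathbf x\in\mathbf X}h(\mathbf x)$. A $\delta$-GLMB with label space $\mathbb L$ and discrete index space $\Xi$ is a random finite set with multi-object density $\Delta(\mathbf X)\sum_{I,\xi}\omega^{(I,\xi)}\delta_I(\mathcal L(\mathbf X))[p^{(\xi)}]^{\mathbf X}$ ($I$ finite $\subseteq\mathbb L$, $\xi\in\Xi$), where $\omega\ge 0$, $\sum_{I,\xi}\omega^{(I,\xi)}=1$, $p^{(\xi)}\ge0$ and $\int p^{(\xi)}(x,\ell)\,dx=1$. Densities are identified when they agree almost everywhere. Between times $k-1$ and $k$, objects $(x,\ell)$ independently survive with probability $p_S(x,\ell)$, keeping their label and moving according to the transition density $f(\cdot|x,\ell)$,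 or die; independently, objects are born according to a labeled multi-Bernoulli RFS with labels in $\mathbb B$, existence probabilities $r(\ell)$ and densities $p_B(\cdot,\ell)$. At time $k$ a finite set $Z_k=\{z_1,\dots,z_M\}$, $M=|Z_k|$, is observed; objects are independently detected with probability $p_D(x,\ell)$, generating a measurement with likelihood $g(z|x,\ell)$, and there is independent Poisson clutter with intensity $\kappa$, $\int\kappa<\infty$. The multi-object posterior at time $k$ is obtained from that at time $k-1$ by the multi-object Chapman–Kolmogorov prediction followed by the multi-object Bayes update, whose denominator is assumed to be positive and finite. Let $\psi(x,\ell;a)=p_D(x,\ell)g(z_a|x,\ell)/\kappa(z_a)$ for $1\le a\le M$ and $\psi(x,\ell;0)=1-p_D(x,\ell)$. **Proposition.** Suppose that the posterior at time $k-1$ is a $\delta$-GLMB with label space $\mathbb L$, index space $\Xi$, weights $\omega_{k-1}^{(I,\xi)}$ and track densities $p_{k-1}^{(\xi)}$. For finite $I\subseteq\mathbb L$ let $\tilde\Theta_{I\cup\mathbb B}$ be the set of extended association maps $\tilde\theta:I\cup\mathbb B\to\{0,1,\dots,M+1\}$ such that $\tilde\theta(i)=\tilde\theta(i')\in\{1,\dots,M\}$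 implies $i=i'$, and let $I_{\tilde\theta}=\{\ell\in I\cup\mathbb B:\tilde\theta(\ell)<M+1\}$. Put $$\eta_S^{(\xi)}(\ell)=\int p_S(x,\ell)p_{k-1}^{(\xi)}(x,\ell)\,dx,\qquad p_{k|k-1}^{(\xi)}(x,\ell)=\begin{cases}\int p_S(x',\ell)f(x|x',\ell)p_{k-1}^{(\xi)}(x',\ell)\,dx'/\eta_S^{(\xi)}(\ell),&\ell\in\mathbb L,\\ p_B(x,\ell),&\ell\in\mathbb B\end{cases}$$ (read as $0$ where $\eta_S^{(\xi)}(\ell)=0$), and $$\eta_{Z_k}^{(\xi,\tilde\theta)}(\ell)=\int p_{k|k-1}^{(\xi)}(x,\ell)\,\psi(x,\ell;\tilde\theta(\ell))\,dx .$$ Then the posterior at time $k$ is a $\delta$-GLMB with label space $\mathbb L\cup\mathbb B$, $$\pi_k(\mathbf X|Z_k)=\Delta(\mathbf X)\sum_{I,\xi}\ \sum_{\tilde\theta\in\tilde\Theta_{I\cup\mathbb B}}\omega_k^{(I,\xi,\tilde\theta)}\,\delta_{I_{\tilde\theta}}(\mathcal L(\mathbf X))\,\bigl[p_k^{(\xi,\tilde\theta)}\bigr]^{\mathbf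 X},$$ where the weights $\omega_k^{(I,\xi,\tilde\theta)}$ sum to $1$ and $$\omega_k^{(I,\xi,\tilde\theta)}\propto\omega_{k-1}^{(I,\xi)}\prod_{\ell\in I\cup\mathbb B}\gamma(\ell),\qquad \gamma(\ell)=\begin{cases}1-\eta_S^{(\xi)}(\ell),&\ell\in I,\ \tilde\theta(\ell)=M+1,\\ \eta_S^{(\xi)}(\ell)\,\eta_{Z_k}^{(\xi,\tilde\theta)}(\ell),&\ell\in I,\ \tilde\theta(\ell)<M+1,\\ 1-r(\ell),&\ell\in\mathbb B,\ \tilde\theta(\ell)=M+1,\\ r(\ell)\,\eta_{Z_k}^{(\xi,\tilde\theta)}(\ell),&\ell\in\mathbb B,\ \tilde\theta(\ell)<M+1,\end{cases}$$ and the track densities satisfy $$p_k^{(\xi,\tilde\theta)}(x,\ell)=\frac{p_{k|k-1}^{(\xi)}(x,\ell)\,\psi(x,\ell;\tilde\theta(\ell))}{\eta_{Z_k}^{(\xi,\tilde\theta)}(\ell)}$$ whenever $\tilde\theta(\ell)<M+1$ and $0<\eta_{Z_k}^{(\xi,\tilde\theta)}(\ell)<\infty$; the latter holds for all $\ell\in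 I_{\tilde\theta}$ in every component of non-zero weight. -/

import Mathlib

open MeasureTheory
open scoped ENNReal

namespace GLMB

noncomputable section

/-! Conventions.  `S` is the kinematic state space with reference measure `μ` (written `dx`), `Λ` is
an ambient type of labels, a labeled state is a pair `(x, ℓ) : S × Λ`, and a multi-object state is a
finite set of labeled states.  All densities are `[0, ∞]`-valued, so every integral and every sum
below is a genuine one. -/

/-- The set of labels of a multi-object state. -/
def labels {S Λ : Type*} (X : Finset (S × Λ)) : Finset Λ :=
  open Classical in X.image Prod.snd

/-- The distinct label indicator. -/
def distinctLabel {S Λ : Type*} (X : Finset (S × Λ)) : ℝ≥0∞ :=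
  if X.card = (labels X).card then 1 else 0

/-- The generalized Kronecker delta. -/
def kron {α : Type*} (Y X : α) : ℝ≥0∞ :=
  open Classical in if X = Y then 1 else 0

/-- The inclusion function for finite sets: `1` if `X ⊆ Y`, else `0`. -/
def incl {α : Type*} (Y X : Finset α) : ℝ≥0∞ :=
  open Classical in if X ⊆ Y then 1 else 0

/-- The multi-object state `{(x₁, ℓ₁), …, (xₙ, ℓₙ)}`. -/
def stateSet {S Λ : Type*} {n : ℕ} (x : Fin n → S) (l : Fin n → Λ) : Finset (S × Λ) :=
  open Classical in Finset.univ.image fun i => (x i, l i)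

/-- The set integral `∑ₙ (1/n!) ∑_{ℓ₁,…,ℓₙ} ∫ F({(x₁,ℓ₁),…,(xₙ,ℓₙ)}) dx₁⋯dxₙ`.  As usual, only tuples
of `n` distinct labeled states count (for Lebesgue measure, or any atomless measure, the other
tuples are negligible). -/
def setLIntegral {S Λ : Type*} [MeasurableSpace S] (μ : Measure S)
    (F : Finset (S × Λ) → ℝ≥0∞) : ℝ≥0∞ :=
  open Classical in
  ∑' n : ℕ, ((n.factorial : ℕ) : ℝ≥0∞)⁻¹ * ∑' l : Fin n → Λ,
    ∫⁻ x : Fin n → S,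
      (if Function.Injective (fun i => (x i, l i)) then F (stateSet x l) else 0)
      ∂(Measure.pi fun _ => μ)

/-- Two multi-object densities agree almost everywhere, with respect to the reference measure of the
set integral. -/
def SetAEEq {S Λ : Type*} [MeasurableSpace S] (μ : Measure S)
    (F G : Finset (S × Λ) → ℝ≥0∞) : Prop :=
  ∀ (n : ℕ) (l : Fin n → Λ), ∀ᵐ x : Fin n → S ∂(Measure.pi fun _ => μ),
    Function.Injective (fun i => (x i, l i)) → F (stateSet x l) = G (stateSet x l)

/-- `π` is the density of a δ-GLMB random finite set with state space `S`, label space `𝕃`, index space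
`Ξ`, weights `ω I ξ` (`I` a finite subset of `𝕃`; the weight is `0` for other `I`) and track densities
`p ξ · ℓ`, `ℓ ∈ 𝕃`. -/
structure IsDeltaGLMB {S Λ Ξ : Type*} [MeasurableSpace S] (μ : Measure S) (𝕃 : Set Λ)
    (π : Finset (S × Λ) → ℝ≥0∞) (ω : Finset Λ → Ξ → ℝ≥0∞) (p : Ξ → S → Λ → ℝ≥0∞) : Prop where
  weight_eq_zero : ∀ (I : Finset Λ) (ξ : Ξ), ¬ ((I : Set Λ) ⊆ 𝕃) → ω I ξ = 0
  tsum_weight : ∑' I : Finset Λ, ∑' ξ : Ξ, ω I ξ = 1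
  measurable_track : ∀ ξ, ∀ ℓ ∈ 𝕃, Measurable fun x => p ξ x ℓ
  lintegral_track : ∀ ξ, ∀ ℓ ∈ 𝕃, ∫⁻ x, p ξ x ℓ ∂μ = 1
  density : SetAEEq μ π fun X =>
    distinctLabel X * ∑' I : Finset Λ, ∑' ξ : Ξ,
      ω I ξ * kron I (labels X) * ∏ y ∈ X, p ξ y.1 y.2

/-- Single-object dynamics: survival probability `pS x ℓ` and transition density `f x x' ℓ` (from `x'`
to `x`, for an object with label `ℓ`). -/
structure Motion (S Λ : Type*) [MeasurableSpace S] (μ : Measure S) where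
  pS : S → Λ → ℝ≥0∞
  f : S → S → Λ → ℝ≥0∞
  pS_le_one : ∀ x ℓ, pS x ℓ ≤ 1
  measurable_pS : ∀ ℓ, Measurable fun x => pS x ℓ
  measurable_f : ∀ ℓ, Measurable fun q : S × S => f q.1 q.2 ℓ
  lintegral_f : ∀ x' ℓ, ∫⁻ x, f x x' ℓ ∂μ = 1

/-- Labeled multi-Bernoulli births with finite label set `𝔹`: existence probability `r ℓ` and
density `pB · ℓ` of a newborn object with label `ℓ`. -/
structure Birth (S Λ : Type*) [MeasurableSpace S] (μ : Measure S) (𝔹 : Finset Λ) where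
  r : Λ → ℝ≥0∞
  pB : S → Λ → ℝ≥0∞
  r_le_one : ∀ ℓ ∈ 𝔹, r ℓ ≤ 1
  measurable_pB : ∀ ℓ ∈ 𝔹, Measurable fun x => pB x ℓ
  lintegral_pB : ∀ ℓ ∈ 𝔹, ∫⁻ x, pB x ℓ ∂μ = 1

/-- Observation model: detection probability `pD x ℓ`, measurement likelihood `g z x ℓ`, and the
intensity `κ` of the Poisson clutter, on the measurement space `O` with reference measure `ν`. -/
structure Sensor (S Λ O : Type*) [MeasurableSpace S] [MeasurableSpace O] (ν : Measure O) where
  pD : S → Λ → ℝ≥0∞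
  g : O → S → Λ → ℝ≥0∞
  κ : O → ℝ≥0∞
  pD_le_one : ∀ x ℓ, pD x ℓ ≤ 1
  measurable_pD : ∀ ℓ, Measurable fun x => pD x ℓ
  measurable_g : ∀ ℓ, Measurable fun q : O × S => g q.1 q.2 ℓ
  lintegral_g : ∀ x ℓ, ∫⁻ z, g z x ℓ ∂ν = 1
  measurable_κ : Measurable κ
  lintegral_κ_ne_top : ∫⁻ z, κ z ∂ν ≠ ∞
  κ_ne_top : ∀ z, κ z ≠ ∞

/-! ### Multi-object transition and birth densities -/

section Prediction

variable {S Λ : Type*} [MeasurableSpace S] {μ : Measure S} {𝔹 : Finset Λ}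

/-- The contribution of an object `(x', ℓ)` to the density that the surviving objects form the
set `W`: it either survives with its label and moves to the state it has in `W`, or dies. -/
def Motion.factor (m : Motion S Λ μ) (W : Finset (S × Λ)) (x' : S) (ℓ : Λ) : ℝ≥0∞ :=
  (∑ y ∈ W, kron ℓ y.2 * (m.pS x' ℓ * m.f y.1 x' ℓ)) +
    (1 - incl (labels W) {ℓ}) * (1 - m.pS x' ℓ)

/-- The density of the set `W` of survivors of the multi-object state `X'`. -/
def Motion.survival (m : Motion S Λ μ) (W X' : Finset (S × Λ)) : ℝ≥0∞ :=
  distinctLabel W * distinctLabel X' * incl (labels X') (labels W) *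
    ∏ y ∈ X', m.factor W y.1 y.2

/-- The probability that `J` is the set of labels of the newborn objects. -/
def Birth.weight (b : Birth S Λ μ 𝔹) (J : Finset Λ) : ℝ≥0∞ :=
  open Classical in
  incl 𝔹 J * (∏ ℓ ∈ 𝔹 \ J, (1 - b.r ℓ)) * ∏ ℓ ∈ J, b.r ℓ

/-- The labeled multi-Bernoulli density of the set of newborn objects. -/
def Birth.density (b : Birth S Λ μ 𝔹) (Y : Finset (S × Λ)) : ℝ≥0∞ :=
  distinctLabel Y * b.weight (labels Y) * ∏ y ∈ Y, b.pB y.1 y.2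

/-- The multi-object transition density: objects survive and move independently of each other and
of the births; the survivors in `X` are the elements with label in `𝕃`. -/
def transition (𝕃 : Set Λ) (m : Motion S Λ μ) (b : Birth S Λ μ 𝔹)
    (X X' : Finset (S × Λ)) : ℝ≥0∞ :=
  open Classical in
  m.survival (X.filter fun y => y.2 ∈ 𝕃) X' * b.density (X.filter fun y => y.2 ∉ 𝕃)

/-- The multi-object prediction density (Chapman–Kolmogorov). -/
def prediction (𝕃 : Set Λ) (m : Motion S Λ μ) (b : Birth S Λ μ 𝔹)
    (π : Finset (S × Λ) → ℝ≥0∞) (X : Finset (S × Λ)) : ℝ≥0∞ :=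
  setLIntegral μ fun X' => transition 𝕃 m b X X' * π X'

end Prediction

/-! ### Association maps, multi-object likelihood and Bayes update

A map defined on a finite set `D` of labels is represented by its extension by `0` off `D`. -/

section Update

variable {S Λ O : Type*} [MeasurableSpace S] [MeasurableSpace O] {μ : Measure S}
  {ν : Measure O} {𝔹 : Finset Λ} {M : ℕ}

/-- Association maps with domain `D`: values in `{0, …, M}`, injective on positive values. -/
def assoc (M : ℕ) (D : Finset Λ) : Finset (Λ →₀ ℕ) :=
  open Classical in
  (D.finsupp fun _ => Finset.range (M + 1)).filter fun θ =>
    ∀ i ∈ D, ∀ j ∈ D, θ i = θ j → 0 < θ i → i = j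

/-- Extended association maps with domain `D`: values in `{0, …, M, M + 1}`, injective on values
strictly between `0` and `M + 1`. -/
def extAssoc (M : ℕ) (D : Finset Λ) : Finset (Λ →₀ ℕ) :=
  open Classical in
  (D.finsupp fun _ => Finset.range (M + 2)).filter fun θ =>
    ∀ i ∈ D, ∀ j ∈ D, θ i = θ j → 0 < θ i → θ i < M + 1 → i = j

/-- `ψ_Z(x, ℓ; θ)` with `a = θ ℓ`, for the set of measurements `Z = {z₁, …, z_M}`; the value `a ≥ 1`
stands for the measurement `z_a`, the value `0` for a missed detection. -/
def Sensor.psi (s : Sensor S Λ O ν) (z : Fin M ↪ O) (a : ℕ) (x : S) (ℓ : Λ) : ℝ≥0∞ :=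
  if h : 0 < a ∧ a ≤ M then
    s.pD x ℓ * s.g (z ⟨a - 1, by omega⟩) x ℓ / s.κ (z ⟨a - 1, by omega⟩)
  else 1 - s.pD x ℓ

/-- The multi-object likelihood `g(Z | X)`. -/
def Sensor.likelihood (s : Sensor S Λ O ν) (z : Fin M ↪ O) (X : Finset (S × Λ)) : ℝ≥0∞ :=
  ENNReal.ofReal (Real.exp (-(∫⁻ y, s.κ y ∂ν).toReal)) * (∏ j : Fin M, s.κ (z j)) *
    ∑ θ ∈ assoc M (labels X), ∏ y ∈ X, s.psi z (θ y.2) y.1 y.2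

/-- The denominator of the Bayes update. -/
def evidence (𝕃 : Set Λ) (m : Motion S Λ μ) (b : Birth S Λ μ 𝔹) (s : Sensor S Λ O ν)
    (z : Fin M ↪ O) (π : Finset (S × Λ) → ℝ≥0∞) : ℝ≥0∞ :=
  setLIntegral μ fun X => s.likelihood z X * prediction 𝕃 m b π X

/-- The multi-object posterior density at the next time, by prediction and Bayes update. -/
def posterior (𝕃 : Set Λ) (m : Motion S Λ μ) (b : Birth S Λ μ 𝔹) (s : Sensor S Λ O ν)
    (z : Fin M ↪ O) (π : Finset (S × Λ) → ℝ≥0∞) (X : Finset (S × Λ)) : ℝ≥0∞ :=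
  s.likelihood z X * prediction 𝕃 m b π X / evidence 𝕃 m b s z π

end Update

/-! ### Parameters of the joint prediction and update -/

section Joint

variable {S Λ O Ξ : Type*} [MeasurableSpace S] [MeasurableSpace O] {μ : Measure S}
  {ν : Measure O} {𝔹 : Finset Λ} {M : ℕ}

/-- `η_S^{(ξ)}(ℓ)`: expected survival probability. -/
def etaS (m : Motion S Λ μ) (p : Ξ → S → Λ → ℝ≥0∞) (ξ : Ξ) (ℓ : Λ) : ℝ≥0∞ :=
  ∫⁻ x, m.pS x ℓ * p ξ x ℓ ∂μ

/-- `p_S^{(ξ)}(x, ℓ)`: track density of a surviving object. -/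
def survTrack (m : Motion S Λ μ) (p : Ξ → S → Λ → ℝ≥0∞) (ξ : Ξ) (x : S) (ℓ : Λ) : ℝ≥0∞ :=
  (∫⁻ x', m.pS x' ℓ * m.f x x' ℓ * p ξ x' ℓ ∂μ) / etaS m p ξ ℓ

/-- `p_{k|k-1}^{(ξ)}(x, ℓ)`: predicted track density. -/
def predTrack (𝕃 : Set Λ) (m : Motion S Λ μ) (b : Birth S Λ μ 𝔹) (p : Ξ → S → Λ → ℝ≥0∞)
    (ξ : Ξ) (x : S) (ℓ : Λ) : ℝ≥0∞ :=
  open Classical in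
  (if ℓ ∈ 𝕃 then survTrack m p ξ x ℓ else 0) + (if ℓ ∈ 𝔹 then b.pB x ℓ else 0)

/-- `η_Z^{(ξ,θ)}(ℓ)`. -/
def etaZ (𝕃 : Set Λ) (m : Motion S Λ μ) (b : Birth S Λ μ 𝔹) (s : Sensor S Λ O ν)
    (z : Fin M ↪ O) (p : Ξ → S → Λ → ℝ≥0∞) (ξ : Ξ) (θ : Λ →₀ ℕ) (ℓ : Λ) : ℝ≥0∞ :=
  ∫⁻ x, predTrack 𝕃 m b p ξ x ℓ * s.psi z (θ ℓ) x ℓ ∂μ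

/-- `p_k^{(ξ,θ)}(x, ℓ | Z)`: updated track density. -/
def postTrack (𝕃 : Set Λ) (m : Motion S Λ μ) (b : Birth S Λ μ 𝔹) (s : Sensor S Λ O ν)
    (z : Fin M ↪ O) (p : Ξ → S → Λ → ℝ≥0∞) (ξ : Ξ) (θ : Λ →₀ ℕ) (x : S) (ℓ : Λ) : ℝ≥0∞ :=
  predTrack 𝕃 m b p ξ x ℓ * s.psi z (θ ℓ) x ℓ / etaZ 𝕃 m b s z p ξ θ ℓ

/-- The factor `γ_Z^{(θ(ℓ))}(ℓ)`, for `ℓ ∈ I ∪ 𝔹`. -/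
def gammaZ (𝕃 : Set Λ) (m : Motion S Λ μ) (b : Birth S Λ μ 𝔹) (s : Sensor S Λ O ν)
    (z : Fin M ↪ O) (p : Ξ → S → Λ → ℝ≥0∞) (I : Finset Λ) (ξ : Ξ) (θ : Λ →₀ ℕ) (ℓ : Λ) : ℝ≥0∞ :=
  open Classical in
  if ℓ ∈ I then
    if θ ℓ = M + 1 then 1 - etaS m p ξ ℓ else etaS m p ξ ℓ * etaZ 𝕃 m b s z p ξ θ ℓ
  else
    if θ ℓ = M + 1 then 1 - b.r ℓ else b.r ℓ * etaZ 𝕃 m b s z p ξ θ ℓ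

/-- The domain `I ∪ 𝔹` of the extended association maps that belong to `I`. -/
def jointLabels (𝔹 I : Finset Λ) : Finset Λ := open Classical in I ∪ 𝔹

/-- The labels in `I ∪ 𝔹` that exist after the update: those with value in `{0, …, M}`. -/
def live (M : ℕ) (𝔹 I : Finset Λ) (θ : Λ →₀ ℕ) : Finset Λ :=
  (jointLabels 𝔹 I).filter fun ℓ => θ ℓ < M + 1

/-- The unnormalized weight of the component `(I, ξ, θ)`. -/
def rawWeight (𝕃 : Set Λ) (m : Motion S Λ μ) (b : Birth S Λ μ 𝔹) (s : Sensor S Λ O ν)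
    (z : Fin M ↪ O) (ω : Finset Λ → Ξ → ℝ≥0∞) (p : Ξ → S → Λ → ℝ≥0∞)
    (I : Finset Λ) (ξ : Ξ) (θ : Λ →₀ ℕ) : ℝ≥0∞ :=
  ω I ξ * ∏ ℓ ∈ jointLabels 𝔹 I, gammaZ 𝕃 m b s z p I ξ θ ℓ

/-- The weight of the component `(I, ξ, θ)`, normalized over all eligible components. -/
def postWeight (𝕃 : Set Λ) (m : Motion S Λ μ) (b : Birth S Λ μ 𝔹) (s : Sensor S Λ O ν)
    (z : Fin M ↪ O) (ω : Finset Λ → Ξ → ℝ≥0∞) (p : Ξ → S → Λ → ℝ≥0∞)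
    (I : Finset Λ) (ξ : Ξ) (θ : Λ →₀ ℕ) : ℝ≥0∞ :=
  rawWeight 𝕃 m b s z ω p I ξ θ /
    ∑' I' : Finset Λ, ∑' ξ' : Ξ, ∑ θ' ∈ extAssoc M (jointLabels 𝔹 I'),
      rawWeight 𝕃 m b s z ω p I' ξ' θ'

/-- The weights in δ-GLMB form, with index space `{(I, ξ, θ)}`: the index `(I, ξ, θ)` goes with the
single label set `live M 𝔹 I θ`. -/
def postWeightGLMB (𝕃 : Set Λ) (m : Motion S Λ μ) (b : Birth S Λ μ 𝔹) (s : Sensor S Λ O ν)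
    (z : Fin M ↪ O) (ω : Finset Λ → Ξ → ℝ≥0∞) (p : Ξ → S → Λ → ℝ≥0∞)
    (K : Finset Λ) (q : Finset Λ × Ξ × (Λ →₀ ℕ)) : ℝ≥0∞ :=
  open Classical in
  if q.2.2 ∈ extAssoc M (jointLabels 𝔹 q.1) ∧ K = live M 𝔹 q.1 q.2.2 then
    postWeight 𝕃 m b s z ω p q.1 q.2.1 q.2.2
  else 0

end Joint

end

end GLMB

namespace GLMB

/-! Everything rests on one computation, `setLIntegral_mixture`: the set integral of a mixture of
products, each supported on a single label set, factors into products of single-object integrals,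
because the `n!` orderings of a label set cancel the `1/n!`.

Applied to Chapman–Kolmogorov (`prediction_eq`), it turns each component `(I, ξ)` into a product
over labels. A label that disappears contributes `1 - etaS`, a surviving one `etaS` times its
predicted track. Births have the same form, so in the predicted component every label of `I ∪ 𝔹`
exists independently of the others (`predicted_component`).

The likelihood sums over association maps on the labels of `X`. Sending the remaining labels of `I ∪
𝔹` to `M + 1` identifies these with the extended maps whose live set is `labels X`
(`sum_assoc_eq_sum_extAssoc`). Hence the Bayes numerator is again a mixture of products, indexed by
`(I, ξ, θ)`, at every `X` (`likelihood_mul_prediction`). Integrating it by the same computation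
gives the evidence as the clutter factor times the sum of the raw weights (`evidence_eq`), and the
clutter factor cancels in the quotient.

It remains to write each live factor as a mass times a normalized track. This is delicate where
`etaZ` is `0` or `∞`; `deadCoeff_mul_prod_liveFactor` handles it, up to null sets. -/

/-! ### Integrals of products and sums over labelings -/

theorem lintegral_pi_fin_prod {S : Type*} [MeasurableSpace S] (μ : Measure S) [SigmaFinite μ] :
    ∀ {n : ℕ} (f : Fin n → S → ℝ≥0∞), (∀ i, Measurable (f i)) →
      ∫⁻ x : Fin n → S, ∏ i, f i (x i) ∂(Measure.pi fun _ => μ) = ∏ i, ∫⁻ x, f i x ∂μ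
  | 0, f, _ => by
      simp
  | n + 1, f, hf => by
      have hm : Measurable fun x : Fin (n + 1) → S => ∏ i, f i (x i) :=
        Finset.measurable_prod _ fun i _ => (hf i).comp (measurable_pi_apply i)
      rw [← ((measurePreserving_piFinSuccAbove (fun _ : Fin (n + 1) => μ) 0).symm).lintegral_comp
        hm]
      simp only [MeasurableEquiv.piFinSuccAbove_symm_apply, Fin.insertNthEquiv,
        Fin.prod_univ_succ, Fin.insertNth_zero, Equiv.coe_fn_mk, Fin.cons_succ, Fin.zero_succAbove,
        Fin.cons_zero]
      rw [← lintegral_pi_fin_prod μ (fun i => f i.succ) fun i => hf _]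
      exact lintegral_prod_mul (hf 0).aemeasurable
        (Finset.measurable_prod _ fun (i : Fin n) _ => (hf i.succ).comp (measurable_pi_apply i)).aemeasurable

/-- Summing a function of the label set over ordered labelings, divided by the number of orders. -/
theorem tsum_injective_image {Λ : Type*} [DecidableEq Λ] (F : Finset Λ → ℝ≥0∞) :
    ∑' n : ℕ, ((n.factorial : ℕ) : ℝ≥0∞)⁻¹ * ∑' l : Fin n → Λ,
      (open Classical in if Function.Injective l then F (Finset.univ.image l) else 0) = ∑' I, F I := by
  classical
  have key : ∀ n : ℕ, ((n.factorial : ℕ) : ℝ≥0∞)⁻¹ * ∑' l : Fin n → Λ,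
      (if Function.Injective l then F (Finset.univ.image l) else 0)
        = ∑' I : Finset Λ, if n = I.card then F I else 0 := by
    intro n
    have h1 : ∀ l : Fin n → Λ, (if Function.Injective l then F (Finset.univ.image l) else 0)
        = ∑' I : Finset Λ, if Function.Injective l ∧ Finset.univ.image l = I then F I else 0 := by
      intro l
      rw [tsum_eq_single (Finset.univ.image l)]
      · simp
      · intro I hI
        rw [if_neg]
        exact fun h => hI h.2.symm
    simp_rw [h1]
    rw [ENNReal.tsum_comm, ← ENNReal.tsum_mul_left]
    refine tsum_congr fun I => ?_
    have h2 : ∑' l : Fin n → Λ,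
        (if Function.Injective l ∧ Finset.univ.image l = I then F I else 0)
        = ∑' _ : {l : Fin n → Λ // Function.Injective l ∧ Finset.univ.image l = I}, F I := by
      refine Eq.trans ?_
        (tsum_subtype {l : Fin n → Λ | Function.Injective l ∧ Finset.univ.image l = I}
          (fun _ => F I)).symm
      refine tsum_congr fun l => ?_
      simp [Set.indicator_apply]
    rw [h2]
    split_ifs with hn
    · subst hn
      -- Injective labelings with image `I` are the bijections `Fin I.card ≃ I`; there are `I.card!`
      -- of them, which cancels the prefactor.
      let e : {l : Fin I.card → Λ // Function.Injective l ∧ Finset.univ.image l = I} ≃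
          (Fin I.card ≃ I) :=
        { toFun := fun l => Equiv.ofBijective
            (fun i => ⟨l.1 i, l.2.2.subset (Finset.mem_image_of_mem _ (Finset.mem_univ i))⟩)
            ⟨fun i j hij => l.2.1 (congrArg Subtype.val hij), fun y => by
              obtain ⟨i, -, hi⟩ := Finset.mem_image.1 (l.2.2.superset y.2)
              exact ⟨i, Subtype.ext hi⟩⟩
          invFun := fun e => ⟨fun i => (e i : Λ), Subtype.val_injective.comp e.injective, by
            ext a
            simp only [Finset.mem_image, Finset.mem_univ, true_and]
            exact ⟨fun ⟨i, hi⟩ => hi ▸ (e i).2, fun ha => ⟨e.symm ⟨a, ha⟩, by simp⟩⟩⟩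
          left_inv := fun l => rfl
          right_inv := fun e => by ext; rfl }
      rw [← e.symm.tsum_eq, tsum_fintype]
      rw [Finset.sum_const, Finset.card_univ,
        Fintype.card_equiv (Fintype.equivOfCardEq (by simp)), Fintype.card_fin, nsmul_eq_mul,
        ← mul_assoc, ENNReal.inv_mul_cancel (by exact_mod_cast I.card.factorial_ne_zero)
        (ENNReal.natCast_ne_top _), one_mul]
    · have : IsEmpty {l : Fin n → Λ // Function.Injective l ∧ Finset.univ.image l = I} :=
        ⟨fun l => hn (by rw [← l.2.2, Finset.card_image_of_injective _ l.2.1]; simp)⟩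
      simp
  simp_rw [key]
  rw [ENNReal.tsum_comm]
  refine tsum_congr fun I => ?_
  rw [tsum_ite_eq]

/-- The index type may be uncountable, so the sum is first restricted to the countable support of
the coefficients. Measurability is then needed only there. -/
theorem lintegral_tsum_of_countable {α β : Type*} [MeasurableSpace α] {μ : Measure α} {c : β → ℝ≥0∞}
    (hc : (Function.support c).Countable) {f : β → α → ℝ≥0∞}
    (hf : ∀ q, c q ≠ 0 → Measurable (f q)) :
    ∫⁻ x, ∑' q, c q * f q x ∂μ = ∑' q, c q * ∫⁻ x, f q x ∂μ := by
  have := hc.to_subtype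
  have h : ∀ g : β → ℝ≥0∞, ∑' q, c q * g q = ∑' q : Function.support c, c q * g q := by
    intro g
    refine (tsum_subtype_eq_of_support_subset (f := fun q => c q * g q) ?_).symm
    intro q hq hq'
    exact hq (by simp [hq'])
  simp_rw [h]
  rw [lintegral_tsum fun q => ((hf _ q.2).const_mul _).aemeasurable]
  exact tsum_congr fun q => lintegral_const_mul _ (hf _ q.2)

/-! ### Multi-object states and their set integrals -/

section Sets
variable {S Λ : Type*}

theorem stateSet_injective {n : ℕ} (x : Fin n → S) {l : Fin n → Λ} (hl : Function.Injective l) :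
    Function.Injective fun i => (x i, l i) :=
  fun _ _ h => hl (congrArg Prod.snd h)

theorem labels_stateSet [DecidableEq Λ] {n : ℕ} (x : Fin n → S) (l : Fin n → Λ) :
    labels (stateSet x l) = Finset.univ.image l := by
  ext a
  simp [labels, stateSet]

theorem prod_stateSet {n : ℕ} (x : Fin n → S) {l : Fin n → Λ} (hl : Function.Injective l)
    (F : S × Λ → ℝ≥0∞) : ∏ y ∈ stateSet x l, F y = ∏ i, F (x i, l i) := by
  classical
  rw [stateSet, Finset.prod_image fun i _ j _ h => stateSet_injective x hl h]

theorem distinctLabel_stateSet {n : ℕ} {x : Fin n → S} {l : Fin n → Λ}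
    (h : Function.Injective fun i => (x i, l i)) :
    distinctLabel (stateSet x l) = open Classical in if Function.Injective l then 1 else 0 := by
  classical
  rw [distinctLabel, labels_stateSet, stateSet, Finset.card_image_of_injective _ h]
  congr 1
  rw [eq_comm (a := Finset.card _), Finset.card_image_iff]
  simp

theorem distinctLabel_eq_one_iff {X : Finset (S × Λ)} :
    distinctLabel X = 1 ↔ Set.InjOn Prod.snd (X : Set (S × Λ)) := by
  classical
  rw [distinctLabel, labels, ← Finset.card_image_iff]
  constructor
  · intro h
    by_contra h'
    rw [if_neg (fun h => h' (h.symm.trans (by congr)))] at h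
    simp at h
  · intro h
    rw [if_pos]
    rw [← h]

theorem distinctLabel_eq_zero_or_one (X : Finset (S × Λ)) :
    distinctLabel X = 0 ∨ distinctLabel X = 1 := by
  rw [distinctLabel]
  split_ifs <;> simp

theorem prod_labels {X : Finset (S × Λ)} (hX : distinctLabel X = 1) (F : Λ → ℝ≥0∞) :
    ∏ ℓ ∈ labels X, F ℓ = ∏ y ∈ X, F y.2 := by
  classical
  rw [labels, Finset.prod_image (distinctLabel_eq_one_iff.1 hX)]

variable [MeasurableSpace S]

theorem setLIntegral_congr {μ : Measure S} {F G : Finset (S × Λ) → ℝ≥0∞} (h : SetAEEq μ F G) :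
    setLIntegral μ F = setLIntegral μ G := by
  unfold setLIntegral
  refine tsum_congr fun n => ?_
  congr 1
  refine tsum_congr fun l => lintegral_congr_ae ?_
  filter_upwards [h n l] with x hx
  split_ifs with hi
  · exact hx hi
  · rfl

theorem SetAEEq.mul_left {μ : Measure S} {F G : Finset (S × Λ) → ℝ≥0∞} (h : SetAEEq μ F G)
    (T : Finset (S × Λ) → ℝ≥0∞) : SetAEEq μ (fun X => T X * F X) fun X => T X * G X := by
  intro n l
  filter_upwards [h n l] with x hx hi
  rw [hx hi]

/-- The set integral of a mixture of products, each supported on a single label set. -/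
theorem setLIntegral_mixture (μ : Measure S) [SigmaFinite μ] {ι : Type*} {c : ι → ℝ≥0∞}
    (K : ι → Finset Λ) (h : ι → S → Λ → ℝ≥0∞) (hc : (Function.support c).Countable)
    (hm : ∀ q, c q ≠ 0 → ∀ ℓ ∈ K q, Measurable fun x => h q x ℓ) :
    setLIntegral μ (fun X => distinctLabel X *
        ∑' q, c q * (kron (K q) (labels X) * ∏ y ∈ X, h q y.1 y.2)) =
      ∑' q, c q * ∏ ℓ ∈ K q, ∫⁻ x, h q x ℓ ∂μ := by
  classical
  have key : ∀ (n : ℕ) (l : Fin n → Λ), (∫⁻ x : Fin n → S,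
      (if Function.Injective (fun i => (x i, l i)) then distinctLabel (stateSet x l) *
        ∑' q, c q * (kron (K q) (labels (stateSet x l)) * ∏ y ∈ stateSet x l, h q y.1 y.2)
        else 0) ∂(Measure.pi fun _ => μ)) =
      if Function.Injective l then (fun I => ∑' q, c q * (kron (K q) I *
        ∏ ℓ ∈ K q, ∫⁻ x, h q x ℓ ∂μ)) (Finset.univ.image l) else 0 := by
    intro n l
    by_cases hl : Function.Injective l
    · rw [if_pos hl]
      simp_rw [if_pos (stateSet_injective _ hl), distinctLabel_stateSet (stateSet_injective _ hl),
        if_pos hl, one_mul, labels_stateSet, prod_stateSet _ hl]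
      have hmem : ∀ q, Finset.univ.image l = K q → ∀ i, l i ∈ K q := fun q hq i =>
        hq ▸ Finset.mem_image_of_mem _ (Finset.mem_univ i)
      rw [lintegral_tsum_of_countable hc]
      · refine tsum_congr fun q => ?_
        by_cases hcq : c q = 0
        · simp [hcq]
        congr 1
        -- Off `K q` the Kronecker delta removes the term, so the tracks need be measurable only at
        -- labels in `K q`.
        by_cases hq : Finset.univ.image l = K q
        · simp only [kron, if_pos hq, one_mul]
          rw [lintegral_pi_fin_prod μ (fun i x => h q x (l i))
            fun i => hm q hcq _ (hmem q hq i), ← hq,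
            Finset.prod_image fun i _ j _ hij => hl hij]
        · simp [kron, hq]
      · intro q hcq
        by_cases hq : Finset.univ.image l = K q
        · simp only [kron, if_pos hq, one_mul]
          exact Finset.measurable_prod _ fun i _ =>
            (hm q hcq _ (hmem q hq i)).comp (measurable_pi_apply i)
        · simp [kron, hq]
    -- A repeated label can still give distinct labeled states; such tuples are removed by
    -- `distinctLabel`.
    · rw [if_neg hl]
      refine (lintegral_congr fun x => ?_).trans lintegral_zero
      split_ifs with hi
      · rw [distinctLabel_stateSet hi, if_neg hl, zero_mul]
      · rfl
  calc _ = _ := by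
        unfold setLIntegral
        refine tsum_congr fun n => ?_
        congr 1
        exact tsum_congr fun l => key n l
    _ = _ := tsum_injective_image
      fun I => ∑' q, c q * (kron (K q) I * ∏ ℓ ∈ K q, ∫⁻ x, h q x ℓ ∂μ)
    _ = _ := by
      rw [ENNReal.tsum_comm]
      refine tsum_congr fun q => ?_
      rw [tsum_eq_single (K q)]
      · simp [kron]
      · intro I hI
        simp [kron, hI]

end Sets

/-! ### Splitting a state by its labels -/

section Labels
variable {S Λ : Type*}

/-- Two elements with equal labels fall on the same side of `P`, so every clash of labels is seen
within one of the two parts. -/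
theorem distinctLabel_filter_mul (X : Finset (S × Λ)) (P : Λ → Prop) [DecidablePred P]
    [DecidablePred fun y : S × Λ => P y.2] [DecidablePred fun y : S × Λ => ¬ P y.2] :
    distinctLabel (X.filter fun y => P y.2) * distinctLabel (X.filter fun y => ¬ P y.2) =
      distinctLabel X := by
  have key : distinctLabel X = 1 ↔ distinctLabel (X.filter fun y => P y.2) = 1 ∧
      distinctLabel (X.filter fun y => ¬ P y.2) = 1 := by
    simp only [distinctLabel_eq_one_iff]
    constructor
    · intro h
      exact ⟨h.mono (Finset.coe_subset.2 (Finset.filter_subset _ _)),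
        h.mono (Finset.coe_subset.2 (Finset.filter_subset _ _))⟩
    · rintro ⟨h1, h2⟩ y hy y' hy' hyy
      by_cases hP : P y.2
      · exact h1 (by simpa using ⟨hy, hP⟩) (by simpa using ⟨hy', hyy ▸ hP⟩) hyy
      · exact h2 (by simpa using ⟨hy, hP⟩) (by simpa using ⟨hy', hyy ▸ hP⟩) hyy
  rcases distinctLabel_eq_zero_or_one X with h | h <;>
  rcases distinctLabel_eq_zero_or_one (X.filter fun y => P y.2) with h1 | h1 <;>
  rcases distinctLabel_eq_zero_or_one (X.filter fun y => ¬ P y.2) with h2 | h2 <;>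
  simp_all

theorem labels_filter [DecidableEq Λ] (X : Finset (S × Λ)) (P : Λ → Prop) [DecidablePred P]
    [DecidablePred fun y : S × Λ => P y.2] :
    labels (X.filter fun y => P y.2) = (labels X).filter P := by
  ext a
  simp only [labels, Finset.mem_image, Finset.mem_filter]
  constructor
  · rintro ⟨y, ⟨hy, hP⟩, rfl⟩
    exact ⟨⟨y, hy, rfl⟩, hP⟩
  · rintro ⟨⟨y, hy, rfl⟩, hP⟩
    exact ⟨y, ⟨hy, hP⟩, rfl⟩

theorem mem_labels {X : Finset (S × Λ)} {ℓ : Λ} : ℓ ∈ labels X ↔ ∃ y ∈ X, y.2 = ℓ := by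
  simp [labels]

end Labels

/-! ### Chapman–Kolmogorov prediction -/

section Prediction
variable {S Λ Ξ : Type*} [MeasurableSpace S] {μ : Measure S} {𝔹 : Finset Λ}

theorem Motion.measurable_factor (m : Motion S Λ μ) (W : Finset (S × Λ)) (ℓ : Λ) :
    Measurable fun x => m.factor W x ℓ := by
  unfold Motion.factor
  refine Measurable.add (Finset.measurable_sum _ fun y _ => ?_) ?_
  · exact ((m.measurable_pS ℓ).mul ((m.measurable_f ℓ).comp measurable_prodMk_left)).const_mul _
  · exact (measurable_const.sub (m.measurable_pS ℓ)).const_mul _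

theorem Motion.factor_of_mem (m : Motion S Λ μ) {W : Finset (S × Λ)} (hW : distinctLabel W = 1)
    {y : S × Λ} (hy : y ∈ W) (x : S) : m.factor W x y.2 = m.pS x y.2 * m.f y.1 x y.2 := by
  classical
  rw [Motion.factor, Finset.sum_eq_single_of_mem y hy]
  · have : y.2 ∈ labels W := mem_labels.2 ⟨y, hy, rfl⟩
    simp [kron, incl, this]
  · intro y' hy' hne
    have : y'.2 ≠ y.2 := fun h => hne (distinctLabel_eq_one_iff.1 hW hy' hy h)
    simp [kron, this]

theorem Motion.factor_of_notMem (m : Motion S Λ μ) {W : Finset (S × Λ)} {ℓ : Λ}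
    (hℓ : ℓ ∉ labels W) (x : S) : m.factor W x ℓ = 1 - m.pS x ℓ := by
  classical
  rw [Motion.factor, Finset.sum_eq_zero]
  · simp [incl, hℓ]
  · intro y hy
    have : y.2 ≠ ℓ := fun h => hℓ (mem_labels.2 ⟨y, hy, h⟩)
    simp [kron, this]

variable (m : Motion S Λ μ) {p : Ξ → S → Λ → ℝ≥0∞} {ξ : Ξ} {ℓ : Λ}

theorem etaS_le_one (hp1 : ∫⁻ x, p ξ x ℓ ∂μ = 1) : etaS m p ξ ℓ ≤ 1 := by
  rw [← hp1, etaS]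
  exact lintegral_mono fun x => mul_le_of_le_one_left zero_le (m.pS_le_one x ℓ)

theorem lintegral_death (hp : Measurable fun x => p ξ x ℓ) (hp1 : ∫⁻ x, p ξ x ℓ ∂μ = 1) :
    ∫⁻ x, (1 - m.pS x ℓ) * p ξ x ℓ ∂μ = 1 - etaS m p ξ ℓ := by
  refine ENNReal.eq_sub_of_add_eq ((etaS_le_one m hp1).trans_lt ENNReal.one_lt_top).ne ?_
  refine (lintegral_add_right _ ((m.measurable_pS ℓ).mul hp)).symm.trans ?_
  refine (lintegral_congr fun x => ?_).trans hp1
  rw [Pi.mul_apply, ← add_mul, tsub_add_cancel_of_le (m.pS_le_one x ℓ), one_mul]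

theorem lintegral_survival (hp : Measurable fun x => p ξ x ℓ) (hp1 : ∫⁻ x, p ξ x ℓ ∂μ = 1) (x : S) :
    ∫⁻ x', m.pS x' ℓ * m.f x x' ℓ * p ξ x' ℓ ∂μ = etaS m p ξ ℓ * survTrack m p ξ x ℓ := by
  rw [survTrack]
  -- If `etaS` vanishes, `survTrack` is a junk quotient, but `pS * p` is zero almost everywhere and
  -- so is the integrand on the left.
  by_cases h : etaS m p ξ ℓ = 0
  · rw [h, zero_mul, lintegral_eq_zero_iff']
    · have h' := h
      filter_upwards [(lintegral_eq_zero_iff ((m.measurable_pS ℓ).mul hp)).1 h'] with x' hx'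
      simp only [Pi.mul_apply, Pi.zero_apply] at hx' ⊢
      rw [mul_right_comm, hx', zero_mul]
    · exact (((m.measurable_pS ℓ).mul
        ((m.measurable_f ℓ).comp measurable_prodMk_left)).mul hp).aemeasurable
  · rw [ENNReal.mul_div_cancel h ((etaS_le_one m hp1).trans_lt ENNReal.one_lt_top).ne]

/-- The integrated motion factors of the objects of a component with label set `I`. -/
theorem prod_lintegral_factor {I : Finset Λ} [DecidableEq Λ]
    (hp : ∀ ℓ ∈ I, Measurable fun x => p ξ x ℓ) (hp1 : ∀ ℓ ∈ I, ∫⁻ x, p ξ x ℓ ∂μ = 1)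
    {W : Finset (S × Λ)} (hW : distinctLabel W = 1) (hWI : labels W ⊆ I) :
    ∏ ℓ ∈ I, ∫⁻ x, m.factor W x ℓ * p ξ x ℓ ∂μ =
      (∏ ℓ ∈ I \ labels W, (1 - etaS m p ξ ℓ)) *
        ∏ y ∈ W, etaS m p ξ y.2 * survTrack m p ξ y.1 y.2 := by
  rw [← Finset.prod_sdiff hWI]
  congr 1
  · refine Finset.prod_congr rfl fun ℓ hℓ => ?_
    rw [Finset.mem_sdiff] at hℓ
    simp_rw [m.factor_of_notMem hℓ.2]
    exact lintegral_death m (hp ℓ hℓ.1) (hp1 ℓ hℓ.1)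
  · rw [prod_labels hW]
    refine Finset.prod_congr rfl fun y hy => ?_
    have hyI : y.2 ∈ I := hWI (mem_labels.2 ⟨y, hy, rfl⟩)
    simp_rw [m.factor_of_mem hW hy]
    exact lintegral_survival m (hp _ hyI) (hp1 _ hyI) _

variable {𝕃 : Set Λ} (b : Birth S Λ μ 𝔹) {π : Finset (S × Λ) → ℝ≥0∞}
  {ω : Finset Λ → Ξ → ℝ≥0∞}

theorem IsDeltaGLMB.countable_support (hπ : IsDeltaGLMB μ 𝕃 π ω p) :
    (Function.support fun q : Finset Λ × Ξ => ω q.1 q.2).Countable := by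
  refine Summable.countable_support_ennreal ?_
  rw [ENNReal.tsum_prod, hπ.tsum_weight]
  exact ENNReal.one_ne_top

theorem IsDeltaGLMB.subset (hπ : IsDeltaGLMB μ 𝕃 π ω p) {I : Finset Λ} (h : ω I ξ ≠ 0) :
    (I : Set Λ) ⊆ 𝕃 :=
  not_not.1 fun h' => h (hπ.weight_eq_zero I ξ h')

/-- For fixed `X` the survivors `W` and newborns `Y` are constants of the integration, and the
motion factors join the prior tracks in one product, so `setLIntegral_mixture` applies. Since `π`
enters only under the integral, its almost-everywhere form suffices and the formula holds at every
`X`. -/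
theorem prediction_eq [SigmaFinite μ] (hπ : IsDeltaGLMB μ 𝕃 π ω p) (X : Finset (S × Λ)) {W Y : Finset (S × Λ)}
    (hW : W = open Classical in X.filter fun y => y.2 ∈ 𝕃)
    (hY : Y = open Classical in X.filter fun y => y.2 ∉ 𝕃) :
    prediction 𝕃 m b π X = ∑' q : Finset Λ × Ξ, ω q.1 q.2 *
      (distinctLabel W * b.density Y * incl q.1 (labels W) *
        ∏ ℓ ∈ q.1, ∫⁻ x, m.factor W x ℓ * p q.2 x ℓ ∂μ) := by
  classical
  have h1 : prediction 𝕃 m b π X = setLIntegral μ fun X' => distinctLabel X' *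
      ∑' q : Finset Λ × Ξ, (ω q.1 q.2 * (distinctLabel W * b.density Y * incl q.1 (labels W))) *
        (kron q.1 (labels X') * ∏ y ∈ X', m.factor W y.1 y.2 * p q.2 y.1 y.2) := by
    rw [prediction, setLIntegral_congr (hπ.density.mul_left _)]
    congr 1
    ext X'
    rw [← ENNReal.tsum_prod (f := fun I ξ => ω I ξ * kron I (labels X') * ∏ y ∈ X', p ξ y.1 y.2),
      transition, ← hW, ← hY, Motion.survival]
    rw [← ENNReal.tsum_mul_left, ← ENNReal.tsum_mul_left, ← ENNReal.tsum_mul_left]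
    refine tsum_congr fun q => ?_
    rcases distinctLabel_eq_zero_or_one X' with h | h
    · simp [h]
    by_cases hq : labels X' = q.1
    · rw [h, hq, Finset.prod_mul_distrib]
      ring
    · simp [kron, hq]
  rw [h1, setLIntegral_mixture μ (fun q : Finset Λ × Ξ => q.1)
    (fun q x ℓ => m.factor W x ℓ * p q.2 x ℓ)]
  · exact tsum_congr fun q => mul_assoc _ _ _
  · exact hπ.countable_support.mono fun q hq (h : ω q.1 q.2 = 0) => hq (by simp [h])
  · intro q hq ℓ hℓ
    have : ω q.1 q.2 ≠ 0 := fun h => hq (by simp [h])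
    exact (m.measurable_factor W ℓ).mul (hπ.measurable_track _ _ (hπ.subset this hℓ))

end Prediction

/-! ### Association maps and extended association maps -/

section Assoc
variable {Λ : Type*} {M : ℕ}

theorem mem_assoc {D : Finset Λ} {θ : Λ →₀ ℕ} : θ ∈ assoc M D ↔
    (θ.support ⊆ D ∧ ∀ i ∈ D, θ i < M + 1) ∧
      ∀ i ∈ D, ∀ j ∈ D, θ i = θ j → 0 < θ i → i = j := by
  simp [assoc, Finset.mem_finsupp_iff]

theorem mem_extAssoc {D : Finset Λ} {θ : Λ →₀ ℕ} : θ ∈ extAssoc M D ↔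
    (θ.support ⊆ D ∧ ∀ i ∈ D, θ i < M + 2) ∧
      ∀ i ∈ D, ∀ j ∈ D, θ i = θ j → 0 < θ i → θ i < M + 1 → i = j := by
  simp [extAssoc, Finset.mem_finsupp_iff]

/-- Association maps with domain `L ⊆ D` are extended association maps with domain `D` that are
live exactly on `L`. -/
theorem sum_assoc_eq_sum_extAssoc [DecidableEq Λ] {D L : Finset Λ} (hLD : L ⊆ D)
    {F G : (Λ →₀ ℕ) → ℝ≥0∞} (hFG : ∀ θ θ', (∀ ℓ ∈ L, θ ℓ = θ' ℓ) → F θ = G θ') :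
    ∑ θ ∈ assoc M L, F θ =
      ∑ θ ∈ (extAssoc M D).filter fun θ => L = D.filter fun ℓ => θ ℓ < M + 1, G θ := by
  have hext : ∀ (θ : Λ →₀ ℕ) ℓ, (if ℓ ∈ L then θ ℓ else if ℓ ∈ D then M + 1 else 0) ≠ 0 →
      ℓ ∈ D := by
    intro θ ℓ h
    by_contra hD
    exact h (by rw [if_neg fun h => hD (hLD h), if_neg hD])
  -- Labels of `D` outside `L` receive the death value `M + 1`, and labels off `D` keep the default
  -- `0`. The inverse resets everything off `L` to `0`.
  refine Finset.sum_bij' (fun θ _ => Finsupp.onFinset D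
      (fun ℓ => if ℓ ∈ L then θ ℓ else if ℓ ∈ D then M + 1 else 0) (hext θ))
    (fun θ _ => θ.filter (· ∈ L)) ?_ ?_ ?_ ?_ ?_
  · intro θ hθ
    rw [mem_assoc] at hθ
    rw [Finset.mem_filter, mem_extAssoc]
    refine ⟨⟨⟨Finsupp.support_onFinset_subset, fun i hi => ?_⟩, fun i hi j hj hij h0 hM => ?_⟩, ?_⟩
    · rw [Finsupp.onFinset_apply]
      split_ifs with h
      · have := hθ.1.2 i h
        omega
      · omega
    · simp only [Finsupp.onFinset_apply, if_pos hi, if_pos hj] at hij h0 hM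
      have hiL : i ∈ L := by
        by_contra h
        simp [h] at hM
      have hjL : j ∈ L := by
        by_contra h
        rw [hij] at hM
        simp [h] at hM
      simp only [if_pos hiL, if_pos hjL] at hij h0 hM
      exact hθ.2 i hiL j hjL hij h0
    · ext ℓ
      rw [Finset.mem_filter, Finsupp.onFinset_apply]
      constructor
      · intro h
        exact ⟨hLD h, by rw [if_pos h]; exact hθ.1.2 ℓ h⟩
      · rintro ⟨hD, h⟩
        by_contra hL
        simp [hL, hD] at h
  · intro θ hθ
    rw [Finset.mem_filter, mem_extAssoc] at hθ
    obtain ⟨⟨⟨h1, h2⟩, h3⟩, h4⟩ := hθ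
    have h5 : ∀ i ∈ L, θ i < M + 1 := fun i hi => by
      rw [h4, Finset.mem_filter] at hi
      exact hi.2
    rw [mem_assoc]
    refine ⟨⟨?_, fun i hi => ?_⟩, fun i hi j hj hij h0 => ?_⟩
    · intro i hi
      rw [Finsupp.support_filter, Finset.mem_filter] at hi
      exact hi.2
    · rw [Finsupp.filter_apply_pos _ _ hi]
      exact h5 i hi
    · rw [Finsupp.filter_apply_pos _ _ hi, Finsupp.filter_apply_pos _ _ hj] at hij
      rw [Finsupp.filter_apply_pos _ _ hi] at h0
      exact h3 i (hLD hi) j (hLD hj) hij h0 (h5 i hi)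
  · intro θ hθ
    rw [mem_assoc] at hθ
    ext ℓ
    by_cases h : ℓ ∈ L
    · simp [h]
    · simp only [Finsupp.filter_apply, h, if_false]
      exact (Finsupp.notMem_support_iff.1 fun h' => h (hθ.1.1 h')).symm
  · intro θ hθ
    rw [Finset.mem_filter, mem_extAssoc] at hθ
    obtain ⟨⟨⟨h1, h2⟩, h3⟩, h4⟩ := hθ
    ext ℓ
    rw [Finsupp.onFinset_apply]
    split_ifs with hL hD
    · exact Finsupp.filter_apply_pos _ _ hL
    · have := h2 ℓ hD
      rw [h4, Finset.mem_filter, not_and] at hL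
      have := hL hD
      omega
    · exact (Finsupp.notMem_support_iff.1 fun h' => hD (h1 h')).symm
  · intro θ hθ
    refine hFG _ _ fun ℓ hℓ => ?_
    simp [hℓ]

end Assoc

/-! ### The Bayes numerator as a mixture over triples -/

section Joint
variable {S Λ O Ξ : Type*} [MeasurableSpace S] [MeasurableSpace O] {μ : Measure S}
  {ν : Measure O} {𝔹 : Finset Λ} {M : ℕ}

/-- The probability that the object with label `ℓ ∈ I ∪ 𝔹` exists after the prediction. -/
noncomputable def existProb (m : Motion S Λ μ) (b : Birth S Λ μ 𝔹) (p : Ξ → S → Λ → ℝ≥0∞)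
    (I : Finset Λ) (ξ : Ξ) (ℓ : Λ) : ℝ≥0∞ :=
  open Classical in if ℓ ∈ I then etaS m p ξ ℓ else b.r ℓ

/-- The factor of the likelihood that does not depend on the multi-object state. -/
noncomputable def Sensor.clutterFactor (s : Sensor S Λ O ν) (z : Fin M ↪ O) : ℝ≥0∞ :=
  ENNReal.ofReal (Real.exp (-(∫⁻ y, s.κ y ∂ν).toReal)) * ∏ j : Fin M, s.κ (z j)

/-- The weight of `(I, ξ, θ)` without the factors of the live labels. -/
noncomputable def deadWeight (M : ℕ) (m : Motion S Λ μ) (b : Birth S Λ μ 𝔹)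
    (ω : Finset Λ → Ξ → ℝ≥0∞) (p : Ξ → S → Λ → ℝ≥0∞) (I : Finset Λ) (ξ : Ξ) (θ : Λ →₀ ℕ) : ℝ≥0∞ :=
  open Classical in
  ω I ξ * ∏ ℓ ∈ jointLabels 𝔹 I \ live M 𝔹 I θ, (1 - existProb m b p I ξ ℓ)

/-- The unnormalized updated density of a live label. -/
noncomputable def liveFactor (𝕃 : Set Λ) (m : Motion S Λ μ) (b : Birth S Λ μ 𝔹)
    (s : Sensor S Λ O ν) (z : Fin M ↪ O) (p : Ξ → S → Λ → ℝ≥0∞)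
    (I : Finset Λ) (ξ : Ξ) (θ : Λ →₀ ℕ) (x : S) (ℓ : Λ) : ℝ≥0∞ :=
  existProb m b p I ξ ℓ * (predTrack 𝕃 m b p ξ x ℓ * s.psi z (θ ℓ) x ℓ)

theorem mem_jointLabels {I : Finset Λ} {ℓ : Λ} : ℓ ∈ jointLabels 𝔹 I ↔ ℓ ∈ I ∨ ℓ ∈ 𝔹 := by
  simp [jointLabels]

theorem live_subset {I : Finset Λ} {θ : Λ →₀ ℕ} : live M 𝔹 I θ ⊆ jointLabels 𝔹 I :=
  Finset.filter_subset _ _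

theorem mem_live {I : Finset Λ} {θ : Λ →₀ ℕ} {ℓ : Λ} :
    ℓ ∈ live M 𝔹 I θ ↔ ℓ ∈ jointLabels 𝔹 I ∧ θ ℓ < M + 1 :=
  Finset.mem_filter

variable {𝕃 : Set Λ} {m : Motion S Λ μ} {b : Birth S Λ μ 𝔹} {s : Sensor S Λ O ν}
  {z : Fin M ↪ O} {π : Finset (S × Λ) → ℝ≥0∞} {ω : Finset Λ → Ξ → ℝ≥0∞} {p : Ξ → S → Λ → ℝ≥0∞}

-- Non-zero weight forces `I ⊆ 𝕃`, which is disjoint from `𝔹`, so a label alone tells a survivor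
-- from a newborn. `existProb` and `predTrack` then treat both kinds uniformly, and the products
-- over `I` and `𝔹` merge into one.
open Classical in
theorem predicted_component (h𝔹 : Disjoint 𝕃 (𝔹 : Set Λ)) (hπ : IsDeltaGLMB μ 𝕃 π ω p)
    {X : Finset (S × Λ)} (hX : distinctLabel X = 1) {W Y : Finset (S × Λ)}
    (hW : W = X.filter fun y => y.2 ∈ 𝕃)
    (hY : Y = X.filter fun y => y.2 ∉ 𝕃) {I : Finset Λ} {ξ : Ξ}
    (hω : ω I ξ ≠ 0) :
    distinctLabel W * b.density Y * incl I (labels W) *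
        ∏ ℓ ∈ I, ∫⁻ x, m.factor W x ℓ * p ξ x ℓ ∂μ =
      incl (jointLabels 𝔹 I) (labels X) *
        ((∏ ℓ ∈ jointLabels 𝔹 I \ labels X, (1 - existProb m b p I ξ ℓ)) *
        ∏ y ∈ X, existProb m b p I ξ y.2 * predTrack 𝕃 m b p ξ y.1 y.2) := by
  have hI := hπ.subset hω
  have hLB : ∀ ℓ ∈ 𝕃, ℓ ∉ 𝔹 := fun ℓ h h' => Set.disjoint_left.1 h𝔹 h h'
  have hWY : distinctLabel W * distinctLabel Y = 1 := by
    rw [← hX, ← distinctLabel_filter_mul X (· ∈ 𝕃), hW, hY]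
  have hW1 : distinctLabel W = 1 := by
    rcases distinctLabel_eq_zero_or_one W with h | h
    · simp [h] at hWY
    · exact h
  have hY1 : distinctLabel Y = 1 := by
    rwa [hW1, one_mul] at hWY
  have hLW : labels W = (labels X).filter (· ∈ 𝕃) := by
    rw [hW, ← labels_filter]
  have hLY : labels Y = (labels X).filter (· ∉ 𝕃) := by
    rw [hY, ← labels_filter]
  by_cases hsub : labels X ⊆ jointLabels 𝔹 I
  · have hWI : labels W ⊆ I := by
      intro ℓ hℓ
      rw [hLW, Finset.mem_filter] at hℓ
      exact (mem_jointLabels.1 (hsub hℓ.1)).resolve_right (hLB ℓ hℓ.2)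
    have hYB : labels Y ⊆ 𝔹 := by
      intro ℓ hℓ
      rw [hLY, Finset.mem_filter] at hℓ
      exact (mem_jointLabels.1 (hsub hℓ.1)).resolve_left fun h => hℓ.2 (hI h)
    rw [prod_lintegral_factor m (fun ℓ hℓ => hπ.measurable_track ξ ℓ (hI hℓ))
      (fun ℓ hℓ => hπ.lintegral_track ξ ℓ (hI hℓ)) hW1 hWI]
    have hdead : ∏ ℓ ∈ jointLabels 𝔹 I \ labels X, (1 - existProb m b p I ξ ℓ) =
        (∏ ℓ ∈ I \ labels W, (1 - etaS m p ξ ℓ)) * ∏ ℓ ∈ 𝔹 \ labels Y, (1 - b.r ℓ) := by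
      have hu : jointLabels 𝔹 I \ labels X = (I \ labels W) ∪ (𝔹 \ labels Y) := by
        ext ℓ
        have h1 : ℓ ∈ I → ℓ ∈ 𝕃 := fun h => hI h
        have h2 := hLB ℓ
        simp only [Finset.mem_sdiff, mem_jointLabels, Finset.mem_union, hLW, hLY,
          Finset.mem_filter]
        tauto
      have hd : Disjoint (I \ labels W) (𝔹 \ labels Y) := by
        rw [Finset.disjoint_left]
        intro ℓ h1 h2
        exact hLB ℓ (hI (Finset.mem_sdiff.1 h1).1) (Finset.mem_sdiff.1 h2).1
      rw [hu, Finset.prod_union hd]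
      congr 1
      · refine Finset.prod_congr rfl fun ℓ hℓ => ?_
        rw [existProb, if_pos (Finset.mem_sdiff.1 hℓ).1]
      · refine Finset.prod_congr rfl fun ℓ hℓ => ?_
        rw [existProb, if_neg fun h : ℓ ∈ I => hLB ℓ (hI h) (Finset.mem_sdiff.1 hℓ).1]
    have hlive : ∏ y ∈ X, existProb m b p I ξ y.2 * predTrack 𝕃 m b p ξ y.1 y.2 =
        (∏ y ∈ W, etaS m p ξ y.2 * survTrack m p ξ y.1 y.2) *
          ∏ y ∈ Y, b.r y.2 * b.pB y.1 y.2 := by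
      rw [← Finset.prod_filter_mul_prod_filter_not X (fun y => y.2 ∈ 𝕃), hW, hY]
      congr 1
      · refine Finset.prod_congr rfl fun y hy => ?_
        have hyW : y.2 ∈ labels W := mem_labels.2 ⟨y, hW ▸ hy, rfl⟩
        have hyL := (Finset.mem_filter.1 hy).2
        rw [existProb, if_pos (hWI hyW), predTrack, if_pos hyL, if_neg (hLB _ hyL), add_zero]
      · refine Finset.prod_congr rfl fun y hy => ?_
        have hyY : y.2 ∈ labels Y := mem_labels.2 ⟨y, hY ▸ hy, rfl⟩
        have hyL := (Finset.mem_filter.1 hy).2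
        rw [existProb, if_neg fun h : y.2 ∈ I => hyL (hI h), predTrack, if_neg hyL, if_pos (hYB hyY),
          zero_add]
    rw [hdead, hlive, Birth.density, Birth.weight, hW1, hY1, prod_labels hY1,
      Finset.prod_mul_distrib (s := Y)]
    simp only [incl, if_pos hWI, if_pos hYB, if_pos hsub]
    simp only [one_mul, mul_one]
    ring
  · have hnot : ¬ labels W ⊆ I ∨ ¬ labels Y ⊆ 𝔹 := by
      by_contra! h
      refine hsub fun ℓ hℓ => mem_jointLabels.2 ?_
      by_cases hL : ℓ ∈ 𝕃
      · exact Or.inl (h.1 (by rw [hLW]; exact Finset.mem_filter.2 ⟨hℓ, hL⟩))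
      · exact Or.inr (h.2 (by rw [hLY]; exact Finset.mem_filter.2 ⟨hℓ, hL⟩))
    rcases hnot with h | h
    · simp [incl, h, hsub]
    · simp [Birth.density, Birth.weight, incl, h, hsub]

-- Association maps on `labels X` become extended maps with that live set; the `psi` factors join
-- the predicted tracks to form `liveFactor`, and the labels absent from `X` make up `deadWeight`.
-- If `X` has a label outside `I ∪ 𝔹`, no live set matches and both sides vanish.
open Classical in
theorem likelihood_mul_component (X : Finset (S × Λ)) (I : Finset Λ) (ξ : Ξ) :
    (∑ θ ∈ assoc M (labels X), ∏ y ∈ X, s.psi z (θ y.2) y.1 y.2) * (ω I ξ *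
      (incl (jointLabels 𝔹 I) (labels X) *
        ((∏ ℓ ∈ jointLabels 𝔹 I \ labels X, (1 - existProb m b p I ξ ℓ)) *
        ∏ y ∈ X, existProb m b p I ξ y.2 * predTrack 𝕃 m b p ξ y.1 y.2))) =
    ∑ θ ∈ extAssoc M (jointLabels 𝔹 I), deadWeight M m b ω p I ξ θ *
      (kron (live M 𝔹 I θ) (labels X) * ∏ y ∈ X, liveFactor 𝕃 m b s z p I ξ θ y.1 y.2) := by
  by_cases hsub : labels X ⊆ jointLabels 𝔹 I
  · rw [Finset.sum_mul, sum_assoc_eq_sum_extAssoc (M := M) hsub (G := fun θ =>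
      (∏ y ∈ X, s.psi z (θ y.2) y.1 y.2) * (ω I ξ * (incl (jointLabels 𝔹 I) (labels X) *
        ((∏ ℓ ∈ jointLabels 𝔹 I \ labels X, (1 - existProb m b p I ξ ℓ)) *
        ∏ y ∈ X, existProb m b p I ξ y.2 * predTrack 𝕃 m b p ξ y.1 y.2)))), Finset.sum_filter]
    · refine Finset.sum_congr rfl fun θ _ => ?_
      rw [← live]
      by_cases hθ : labels X = live M 𝔹 I θ
      · rw [if_pos hθ]
        simp only [incl, if_pos hsub, kron, if_true, one_mul, deadWeight, ← hθ, liveFactor]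
        rw [← Finset.prod_congr rfl fun y _ => mul_assoc _ _ _, Finset.prod_mul_distrib (s := X)
          (f := fun y => existProb m b p I ξ y.2 * predTrack 𝕃 m b p ξ y.1 y.2)]
        ring
      · rw [if_neg hθ]
        simp [kron, hθ]
    · intro θ θ' h
      congr 1
      exact Finset.prod_congr rfl fun y hy => by rw [h _ (mem_labels.2 ⟨y, hy, rfl⟩)]
  · rw [incl, if_neg hsub, zero_mul, mul_zero, mul_zero, eq_comm]
    refine Finset.sum_eq_zero fun θ _ => ?_
    have : labels X ≠ live M 𝔹 I θ := fun h => hsub (h ▸ live_subset)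
    simp [kron, this]

/-- Sums over all eligible components, as sums over triples. -/
theorem tsum_components (F : Finset Λ → Ξ → (Λ →₀ ℕ) → ℝ≥0∞) :
    ∑' I : Finset Λ, ∑' ξ : Ξ, ∑ θ ∈ extAssoc M (jointLabels 𝔹 I), F I ξ θ =
      ∑' q : Finset Λ × Ξ × (Λ →₀ ℕ), open Classical in
        if q.2.2 ∈ extAssoc M (jointLabels 𝔹 q.1) then F q.1 q.2.1 q.2.2 else 0 := by
  classical
  rw [ENNReal.tsum_prod']
  refine tsum_congr fun I => ?_
  rw [ENNReal.tsum_prod']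
  refine tsum_congr fun ξ => ?_
  rw [tsum_eq_sum (s := extAssoc M (jointLabels 𝔹 I)) fun θ hθ => if_neg hθ]
  exact Finset.sum_congr rfl fun θ hθ => (if_pos hθ).symm

/-- `deadWeight`, extended by zero to all triples. -/
noncomputable def deadCoeff (M : ℕ) (m : Motion S Λ μ) (b : Birth S Λ μ 𝔹)
    (ω : Finset Λ → Ξ → ℝ≥0∞) (p : Ξ → S → Λ → ℝ≥0∞) (q : Finset Λ × Ξ × (Λ →₀ ℕ)) : ℝ≥0∞ :=
  open Classical in
  if q.2.2 ∈ extAssoc M (jointLabels 𝔹 q.1) then deadWeight M m b ω p q.1 q.2.1 q.2.2 else 0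

theorem likelihood_mul_prediction [SigmaFinite μ] (h𝔹 : Disjoint 𝕃 (𝔹 : Set Λ))
    (hπ : IsDeltaGLMB μ 𝕃 π ω p) (X : Finset (S × Λ)) :
    s.likelihood z X * prediction 𝕃 m b π X = s.clutterFactor z * (distinctLabel X *
      ∑' q : Finset Λ × Ξ × (Λ →₀ ℕ), deadCoeff M m b ω p q *
        (kron (live M 𝔹 q.1 q.2.2) (labels X) *
          ∏ y ∈ X, liveFactor 𝕃 m b s z p q.1 q.2.1 q.2.2 y.1 y.2)) := by
  classical
  rw [prediction_eq m b hπ X rfl rfl, Sensor.likelihood, ← Sensor.clutterFactor, mul_assoc]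
  congr 1
  rcases distinctLabel_eq_zero_or_one X with hX | hX
  · rw [hX, zero_mul]
    refine mul_eq_zero_of_right _ (ENNReal.tsum_eq_zero.2 fun q => ?_)
    -- A repeated label in `X` is repeated among the survivors or among the newborns, and either
    -- density then vanishes.
    have h0 := distinctLabel_filter_mul X (· ∈ 𝕃)
    rw [hX, mul_eq_zero] at h0
    rcases h0 with h0 | h0 <;> simp [Birth.density, h0]
  · rw [hX, one_mul]
    have h1 := tsum_components (M := M) (𝔹 := 𝔹) fun I (ξ : Ξ) θ => deadWeight M m b ω p I ξ θ *
      (kron (live M 𝔹 I θ) (labels X) * ∏ y ∈ X, liveFactor 𝕃 m b s z p I ξ θ y.1 y.2)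
    simp only [deadCoeff, ite_mul, zero_mul]
    rw [← h1, ENNReal.tsum_prod', ← ENNReal.tsum_mul_left]
    refine tsum_congr fun I => ?_
    rw [← ENNReal.tsum_mul_left]
    refine tsum_congr fun ξ => ?_
    rw [← likelihood_mul_component]
    by_cases hω : ω I ξ = 0
    · simp [hω]
    · rw [predicted_component h𝔹 hπ hX rfl rfl hω]

end Joint

/-! ### Weights, evidence and normalized tracks -/

section Joint
variable {S Λ O Ξ : Type*} [MeasurableSpace S] [MeasurableSpace O] {μ : Measure S}
  {ν : Measure O} {𝔹 : Finset Λ} {M : ℕ}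
  {𝕃 : Set Λ} {m : Motion S Λ μ} {b : Birth S Λ μ 𝔹} {s : Sensor S Λ O ν}
  {z : Fin M ↪ O} {π : Finset (S × Λ) → ℝ≥0∞} {ω : Finset Λ → Ξ → ℝ≥0∞} {p : Ξ → S → Λ → ℝ≥0∞}

theorem gammaZ_eq (I : Finset Λ) (ξ : Ξ) (θ : Λ →₀ ℕ) (ℓ : Λ) :
    gammaZ 𝕃 m b s z p I ξ θ ℓ = if θ ℓ = M + 1 then 1 - existProb m b p I ξ ℓ
      else existProb m b p I ξ ℓ * etaZ 𝕃 m b s z p ξ θ ℓ := by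
  unfold gammaZ existProb
  split_ifs <;> rfl

theorem Sensor.measurable_psi (s : Sensor S Λ O ν) (z : Fin M ↪ O) (a : ℕ) (ℓ : Λ) :
    Measurable fun x => s.psi z a x ℓ := by
  unfold Sensor.psi
  split_ifs with h
  · exact ((s.measurable_pD ℓ).mul ((s.measurable_g ℓ).comp measurable_prodMk_left)).div_const _
  · exact measurable_const.sub (s.measurable_pD ℓ)

theorem measurable_predTrack [SigmaFinite μ] (hπ : IsDeltaGLMB μ 𝕃 π ω p) (ξ : Ξ) (ℓ : Λ) :
    Measurable fun x => predTrack 𝕃 m b p ξ x ℓ := by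
  unfold predTrack
  refine Measurable.add ?_ ?_
  · split_ifs with h
    · unfold survTrack
      refine (Measurable.lintegral_prod_right ?_).div_const _
      exact (((m.measurable_pS ℓ).comp measurable_snd).mul (m.measurable_f ℓ)).mul
        ((hπ.measurable_track ξ ℓ h).comp measurable_snd)
    · exact measurable_const
  · split_ifs with h
    · exact b.measurable_pB ℓ h
    · exact measurable_const

theorem measurable_predTrack_mul_psi [SigmaFinite μ] (hπ : IsDeltaGLMB μ 𝕃 π ω p) (ξ : Ξ) (a : ℕ)
    (ℓ : Λ) : Measurable fun x => predTrack 𝕃 m b p ξ x ℓ * s.psi z a x ℓ :=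
  (measurable_predTrack hπ ξ ℓ).mul (s.measurable_psi z a ℓ)

theorem lintegral_liveFactor [SigmaFinite μ] (hπ : IsDeltaGLMB μ 𝕃 π ω p) (I : Finset Λ) (ξ : Ξ)
    (θ : Λ →₀ ℕ) (ℓ : Λ) : ∫⁻ x, liveFactor 𝕃 m b s z p I ξ θ x ℓ ∂μ =
      existProb m b p I ξ ℓ * etaZ 𝕃 m b s z p ξ θ ℓ :=
  lintegral_const_mul _ (measurable_predTrack_mul_psi hπ ξ _ ℓ)

theorem rawWeight_eq {I : Finset Λ} {ξ : Ξ} {θ : Λ →₀ ℕ} (hθ : θ ∈ extAssoc M (jointLabels 𝔹 I)) :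
    rawWeight 𝕃 m b s z ω p I ξ θ = deadWeight M m b ω p I ξ θ *
      ∏ ℓ ∈ live M 𝔹 I θ, existProb m b p I ξ ℓ * etaZ 𝕃 m b s z p ξ θ ℓ := by
  classical
  rw [rawWeight, deadWeight, ← Finset.prod_sdiff (live_subset (M := M) (θ := θ)), mul_assoc]
  congr 2
  · refine Finset.prod_congr (by congr!) fun ℓ hℓ => ?_
    rw [Finset.mem_sdiff, mem_live, not_and] at hℓ
    -- Values of an extended map are at most `M + 1`, so a label that is not live has exactly this
    -- value.
    have h1 := (mem_extAssoc.1 hθ).1.2 ℓ hℓ.1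
    have h2 := hℓ.2 hℓ.1
    rw [gammaZ_eq, if_pos (by omega)]
  · refine Finset.prod_congr rfl fun ℓ hℓ => ?_
    rw [gammaZ_eq, if_neg (mem_live.1 hℓ).2.ne]

/-- `rawWeight`, extended by zero to all triples. -/
noncomputable def rawCoeff (𝕃 : Set Λ) (m : Motion S Λ μ) (b : Birth S Λ μ 𝔹)
    (s : Sensor S Λ O ν) (z : Fin M ↪ O) (ω : Finset Λ → Ξ → ℝ≥0∞) (p : Ξ → S → Λ → ℝ≥0∞)
    (q : Finset Λ × Ξ × (Λ →₀ ℕ)) : ℝ≥0∞ :=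
  open Classical in
  if q.2.2 ∈ extAssoc M (jointLabels 𝔹 q.1) then rawWeight 𝕃 m b s z ω p q.1 q.2.1 q.2.2 else 0

theorem rawCoeff_eq (q : Finset Λ × Ξ × (Λ →₀ ℕ)) :
    rawCoeff 𝕃 m b s z ω p q = deadCoeff M m b ω p q *
      ∏ ℓ ∈ live M 𝔹 q.1 q.2.2, existProb m b p q.1 q.2.1 ℓ * etaZ 𝕃 m b s z p q.2.1 q.2.2 ℓ := by
  unfold rawCoeff deadCoeff
  split_ifs with h
  · exact rawWeight_eq h
  · rw [zero_mul]

theorem tsum_rawWeight : ∑' I : Finset Λ, ∑' ξ : Ξ, ∑ θ ∈ extAssoc M (jointLabels 𝔹 I),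
    rawWeight 𝕃 m b s z ω p I ξ θ = ∑' q, rawCoeff 𝕃 m b s z ω p q :=
  tsum_components _

/-- Only countably many `(I, ξ)` have non-zero prior weight, and each admits finitely many extended
maps. -/
theorem countable_support_deadCoeff (hπ : IsDeltaGLMB μ 𝕃 π ω p) :
    (Function.support (deadCoeff M m b ω p)).Countable := by
  classical
  have h := hπ.countable_support.biUnion (t := fun (r : Finset Λ × Ξ) _ =>
    (fun θ => ((r.1, r.2, θ) : Finset Λ × Ξ × (Λ →₀ ℕ))) '' (extAssoc M (jointLabels 𝔹 r.1) : Set _))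
    fun r _ => (Finset.countable_toSet _).image _
  refine h.mono fun q hq => ?_
  rw [Function.mem_support, deadCoeff] at hq
  have hθ : q.2.2 ∈ extAssoc M (jointLabels 𝔹 q.1) := by
    by_contra h
    exact hq (if_neg h)
  rw [if_pos hθ, deadWeight] at hq
  exact Set.mem_biUnion (x := (q.1, q.2.1)) (left_ne_zero_of_mul hq) ⟨q.2.2, hθ, rfl⟩

theorem evidence_eq [SigmaFinite μ] (h𝔹 : Disjoint 𝕃 (𝔹 : Set Λ)) (hπ : IsDeltaGLMB μ 𝕃 π ω p) :
    evidence 𝕃 m b s z π = s.clutterFactor z * ∑' q, rawCoeff 𝕃 m b s z ω p q := by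
  have h1 : evidence 𝕃 m b s z π = setLIntegral μ fun X => distinctLabel X *
      ∑' q : Finset Λ × Ξ × (Λ →₀ ℕ), (s.clutterFactor z * deadCoeff M m b ω p q) *
        (kron (live M 𝔹 q.1 q.2.2) (labels X) *
          ∏ y ∈ X, liveFactor 𝕃 m b s z p q.1 q.2.1 q.2.2 y.1 y.2) := by
    unfold evidence
    congr 1
    ext X
    rw [likelihood_mul_prediction h𝔹 hπ, mul_left_comm, ← ENNReal.tsum_mul_left]
    simp_rw [mul_assoc]
  rw [h1, setLIntegral_mixture μ (fun q : Finset Λ × Ξ × (Λ →₀ ℕ) => live M 𝔹 q.1 q.2.2)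
    (fun q x ℓ => liveFactor 𝕃 m b s z p q.1 q.2.1 q.2.2 x ℓ), ← ENNReal.tsum_mul_left]
  · refine tsum_congr fun q => ?_
    simp_rw [lintegral_liveFactor hπ, rawCoeff_eq, mul_assoc]
  · exact (countable_support_deadCoeff hπ).mono fun q hq => right_ne_zero_of_mul hq
  · intro q _ ℓ _
    exact (measurable_predTrack_mul_psi hπ _ _ ℓ).const_mul _

open Classical in
/-- The updated track densities, completed by some probability density where the update is not
defined. -/
noncomputable def completedTrack (𝕃 : Set Λ) (m : Motion S Λ μ) (b : Birth S Λ μ 𝔹)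
    (s : Sensor S Λ O ν) (z : Fin M ↪ O) (p : Ξ → S → Λ → ℝ≥0∞)
    (ξ : Ξ) (θ : Λ →₀ ℕ) (x : S) (ℓ : Λ) : ℝ≥0∞ :=
  if etaZ 𝕃 m b s z p ξ θ ℓ ≠ 0 ∧ etaZ 𝕃 m b s z p ξ θ ℓ ≠ ∞ then postTrack 𝕃 m b s z p ξ θ x ℓ
  else if ℓ ∈ 𝕃 then p ξ x ℓ else b.pB x ℓ

theorem measurable_completedTrack [SigmaFinite μ] (hπ : IsDeltaGLMB μ 𝕃 π ω p) (ξ : Ξ)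
    (θ : Λ →₀ ℕ) {ℓ : Λ} (hℓ : ℓ ∈ 𝕃 ∪ (𝔹 : Set Λ)) :
    Measurable fun x => completedTrack 𝕃 m b s z p ξ θ x ℓ := by
  unfold completedTrack
  split_ifs with h h'
  · exact (measurable_predTrack_mul_psi hπ _ _ ℓ).div_const _
  · exact hπ.measurable_track ξ ℓ h'
  · exact b.measurable_pB ℓ (hℓ.resolve_left h')

theorem lintegral_completedTrack [SigmaFinite μ] (hπ : IsDeltaGLMB μ 𝕃 π ω p) (ξ : Ξ)
    (θ : Λ →₀ ℕ) {ℓ : Λ} (hℓ : ℓ ∈ 𝕃 ∪ (𝔹 : Set Λ)) :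
    ∫⁻ x, completedTrack 𝕃 m b s z p ξ θ x ℓ ∂μ = 1 := by
  unfold completedTrack
  split_ifs with h h'
  · simp_rw [postTrack, div_eq_mul_inv]
    rw [lintegral_mul_const _ (measurable_predTrack_mul_psi hπ _ _ ℓ)]
    exact ENNReal.mul_inv_cancel h.1 h.2
  · exact hπ.lintegral_track ξ ℓ h'
  · exact b.lintegral_pB ℓ (hℓ.resolve_left h')

theorem prod_ne_top_imp {ι : Type*} {t : Finset ι} {f : ι → ℝ≥0∞} (h : ∏ i ∈ t, f i ≠ ∞)
    (h0 : ∀ i ∈ t, f i ≠ 0) {i : ι} (hi : i ∈ t) : f i ≠ ∞ := by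
  classical
  intro hf
  rw [← Finset.mul_prod_erase t f hi, hf, ENNReal.top_mul] at h
  · exact h rfl
  · exact Finset.prod_ne_zero_iff.2 fun j hj => h0 j (Finset.mem_of_mem_erase hj)

/-- A product in `[0, ∞]` that is neither `0` nor `∞` has no factor equal to `0` or `∞`. -/
theorem etaZ_ne_of_rawWeight_ne {I : Finset Λ} {ξ : Ξ} {θ : Λ →₀ ℕ}
    (hθ : θ ∈ extAssoc M (jointLabels 𝔹 I)) (h0 : rawWeight 𝕃 m b s z ω p I ξ θ ≠ 0)
    (h1 : rawWeight 𝕃 m b s z ω p I ξ θ ≠ ∞) {ℓ : Λ} (hℓ : ℓ ∈ live M 𝔹 I θ) :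
    etaZ 𝕃 m b s z p ξ θ ℓ ≠ 0 ∧ etaZ 𝕃 m b s z p ξ θ ℓ ≠ ∞ := by
  rw [rawWeight_eq hθ] at h0 h1
  have h2 := left_ne_zero_of_mul h0
  have h3 := Finset.prod_ne_zero_iff.1 (right_ne_zero_of_mul h0)
  have h4 := prod_ne_top_imp (fun h => h1 (by rw [h, ENNReal.mul_top h2])) h3 hℓ
  refine ⟨right_ne_zero_of_mul (h3 ℓ hℓ), fun h => h4 ?_⟩
  rw [h, ENNReal.mul_top (left_ne_zero_of_mul (h3 ℓ hℓ))]

/-- Where `0 < etaZ < ∞`, a live factor is `existProb * etaZ` times the normalized track. The other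
cases must be shown to contribute nothing to either side. -/
theorem deadCoeff_mul_prod_liveFactor [SigmaFinite μ] (hπ : IsDeltaGLMB μ 𝕃 π ω p)
    (q : Finset Λ × Ξ × (Λ →₀ ℕ)) (hq : rawCoeff 𝕃 m b s z ω p q ≠ ∞)
    {n : ℕ} {l : Fin n → Λ} (hl : Function.Injective l) :
    ∀ᵐ x : Fin n → S ∂(Measure.pi fun _ => μ),
      deadCoeff M m b ω p q * (kron (live M 𝔹 q.1 q.2.2) (labels (stateSet x l)) *
        ∏ y ∈ stateSet x l, liveFactor 𝕃 m b s z p q.1 q.2.1 q.2.2 y.1 y.2) =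
      rawCoeff 𝕃 m b s z ω p q * (kron (live M 𝔹 q.1 q.2.2) (labels (stateSet x l)) *
        ∏ y ∈ stateSet x l, completedTrack 𝕃 m b s z p q.2.1 q.2.2 y.1 y.2) := by
  classical
  obtain ⟨I, ξ, θ⟩ := q
  simp only at hq ⊢
  simp_rw [prod_stateSet _ hl, labels_stateSet]
  by_cases hd : deadCoeff M m b ω p (I, ξ, θ) = 0
  · refine Filter.Eventually.of_forall fun x => ?_
    rw [rawCoeff_eq, hd]
    simp
  by_cases hI : Finset.univ.image l = live M 𝔹 I θ
  swap
  · refine Filter.Eventually.of_forall fun x => ?_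
    simp [kron, hI]
  rw [rawCoeff_eq] at hq ⊢
  simp only at hq ⊢
  rw [← hI, Finset.prod_image fun i _ j _ h => hl h] at hq ⊢
  simp only [kron, if_true, one_mul]
  -- Here the raw weight is zero, but the live factor vanishes only for almost every state of that
  -- object. This is the one place where the density formula loses a null set.
  by_cases h0 : ∃ i, etaZ 𝕃 m b s z p ξ θ (l i) = 0
  · obtain ⟨i, hi⟩ := h0
    have hz := (lintegral_eq_zero_iff (measurable_predTrack_mul_psi hπ ξ (θ (l i)) (l i))).1 hi
    filter_upwards [Measure.tendsto_eval_ae_ae.eventually hz] with x hx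
    rw [Finset.prod_eq_zero (Finset.mem_univ i), Finset.prod_eq_zero (Finset.mem_univ i)]
    · simp
    · rw [hi, mul_zero]
    · exact mul_eq_zero_of_right _ hx
  push Not at h0
  refine Filter.Eventually.of_forall fun x => ?_
  by_cases ha : ∃ i, existProb m b p I ξ (l i) = 0
  · obtain ⟨i, hi⟩ := ha
    rw [Finset.prod_eq_zero (Finset.mem_univ i), Finset.prod_eq_zero (Finset.mem_univ i)]
    · simp
    · rw [hi, zero_mul]
    · exact mul_eq_zero_of_left hi _
  push Not at ha
  -- With all other factors non-zero, an infinite `etaZ` would make the raw weight infinite.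
  have h1 : ∀ i, etaZ 𝕃 m b s z p ξ θ (l i) ≠ ∞ := by
    intro i hi
    refine prod_ne_top_imp (fun h => hq (by rw [h, ENNReal.mul_top hd]))
      (fun i _ => mul_ne_zero (ha i) (h0 i)) (Finset.mem_univ i) ?_
    rw [hi, ENNReal.mul_top (ha i)]
  rw [mul_assoc, ← Finset.prod_mul_distrib]
  congr 1
  refine Finset.prod_congr rfl fun i _ => ?_
  rw [completedTrack, if_pos ⟨h0 i, h1 i⟩, liveFactor, postTrack, mul_assoc,
    ENNReal.mul_div_cancel (h0 i) (h1 i)]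

/-- The updated density, as a sum over triples. -/
theorem posterior_aeEq [SigmaFinite μ] (h𝔹 : Disjoint 𝕃 (𝔹 : Set Λ)) (hπ : IsDeltaGLMB μ 𝕃 π ω p)
    (hN0 : evidence 𝕃 m b s z π ≠ 0) (hN1 : evidence 𝕃 m b s z π ≠ ∞) :
    SetAEEq μ (posterior 𝕃 m b s z π) fun X => distinctLabel X * ∑' q : Finset Λ × Ξ × (Λ →₀ ℕ),
      rawCoeff 𝕃 m b s z ω p q / (∑' q, rawCoeff 𝕃 m b s z ω p q) *
        (kron (live M 𝔹 q.1 q.2.2) (labels X) *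
          ∏ y ∈ X, completedTrack 𝕃 m b s z p q.2.1 q.2.2 y.1 y.2) := by
  rw [evidence_eq h𝔹 hπ] at hN0 hN1
  have hC0 := left_ne_zero_of_mul hN0
  have hT0 := right_ne_zero_of_mul hN0
  have hC1 : s.clutterFactor z ≠ ∞ := fun h => hN1 (by rw [h, ENNReal.top_mul hT0])
  have hT1 : ∑' q, rawCoeff 𝕃 m b s z ω p q ≠ ∞ := fun h => hN1 (by rw [h, ENNReal.mul_top hC0])
  intro n l
  -- The exceptional null set depends on the triple; countability of the support gives a common one.
  have hae : Function.Injective l → ∀ᵐ x : Fin n → S ∂(Measure.pi fun _ => μ),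
      ∀ q ∈ Function.support (deadCoeff M m b ω p),
      deadCoeff M m b ω p q * (kron (live M 𝔹 q.1 q.2.2) (labels (stateSet x l)) *
        ∏ y ∈ stateSet x l, liveFactor 𝕃 m b s z p q.1 q.2.1 q.2.2 y.1 y.2) =
      rawCoeff 𝕃 m b s z ω p q * (kron (live M 𝔹 q.1 q.2.2) (labels (stateSet x l)) *
        ∏ y ∈ stateSet x l, completedTrack 𝕃 m b s z p q.2.1 q.2.2 y.1 y.2) := fun hl =>
    (ae_ball_iff (countable_support_deadCoeff hπ)).2 fun q _ =>
      deadCoeff_mul_prod_liveFactor hπ q (ne_top_of_le_ne_top hT1 (ENNReal.le_tsum q)) hl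
  by_cases hl : Function.Injective l
  · filter_upwards [hae hl] with x hx _
    rw [posterior, likelihood_mul_prediction h𝔹 hπ, evidence_eq h𝔹 hπ,
      ENNReal.mul_div_mul_left _ _ hC0 hC1, mul_div_assoc]
    congr 1
    rw [div_eq_mul_inv, ← ENNReal.tsum_mul_right]
    refine tsum_congr fun q => ?_
    rw [div_eq_mul_inv, mul_right_comm (rawCoeff 𝕃 m b s z ω p q)]
    congr 1
    by_cases hq : deadCoeff M m b ω p q = 0
    · rw [rawCoeff_eq, hq]
      simp
    · exact hx q hq
  · refine Filter.Eventually.of_forall fun x hx => ?_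
    have h0 : distinctLabel (stateSet x l) = 0 := by
      rw [distinctLabel_stateSet hx, if_neg hl]
    simp only [posterior, likelihood_mul_prediction h𝔹 hπ, h0, zero_mul, mul_zero,
      ENNReal.zero_div]

open Classical in
theorem postWeight_ite (q : Finset Λ × Ξ × (Λ →₀ ℕ)) :
    (if q.2.2 ∈ extAssoc M (jointLabels 𝔹 q.1) then postWeight 𝕃 m b s z ω p q.1 q.2.1 q.2.2
      else 0) = rawCoeff 𝕃 m b s z ω p q / ∑' q, rawCoeff 𝕃 m b s z ω p q := by
  rw [postWeight, tsum_rawWeight, rawCoeff]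
  split_ifs
  · rfl
  · rw [ENNReal.zero_div]

/-- Each triple contributes to a single label set only. -/
theorem tsum_postWeightGLMB (F : Finset Λ → Finset Λ × Ξ × (Λ →₀ ℕ) → ℝ≥0∞) :
    ∑' K : Finset Λ, ∑' q, postWeightGLMB 𝕃 m b s z ω p K q * F K q =
      ∑' q, rawCoeff 𝕃 m b s z ω p q / (∑' q, rawCoeff 𝕃 m b s z ω p q) *
        F (live M 𝔹 q.1 q.2.2) q := by
  rw [ENNReal.tsum_comm]
  refine tsum_congr fun q => ?_
  rw [tsum_eq_single (live M 𝔹 q.1 q.2.2), ← postWeight_ite]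
  · by_cases h : q.2.2 ∈ extAssoc M (jointLabels 𝔹 q.1) <;> simp [postWeightGLMB, h]
  · intro K hK
    simp [postWeightGLMB, hK]

end Joint

end GLMB

/-! ### The joint prediction and update -/

theorem proposition4 {S Λ O Ξ : Type*} [MeasurableSpace S] [MeasurableSpace O]
    (μ : Measure S) [SigmaFinite μ] (ν : Measure O) [SigmaFinite ν]
    -- label spaces of the previous time and of the births
    (𝕃 : Set Λ) (𝔹 : Finset Λ) (h𝔹 : Disjoint 𝕃 (𝔹 : Set Λ))
    (m : GLMB.Motion S Λ μ) (b : GLMB.Birth S Λ μ 𝔹) (s : GLMB.Sensor S Λ O ν)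
    -- the set of `M` measurements at the current time
    (M : ℕ) (z : Fin M ↪ O)
    -- the previous posterior is a δ-GLMB
    (π : Finset (S × Λ) → ℝ≥0∞) (ω : Finset Λ → Ξ → ℝ≥0∞) (p : Ξ → S → Λ → ℝ≥0∞)
    (hπ : GLMB.IsDeltaGLMB μ 𝕃 π ω p)
    -- Bayes' rule makes sense
    (hN0 : GLMB.evidence 𝕃 m b s z π ≠ 0) (hN1 : GLMB.evidence 𝕃 m b s z π ≠ ∞) :
    ∃ p' : Ξ → (Λ →₀ ℕ) → S → Λ → ℝ≥0∞,
      -- the new posterior is a δ-GLMB with components indexed by `(I, ξ, θ)`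
      GLMB.IsDeltaGLMB μ (𝕃 ∪ (𝔹 : Set Λ)) (GLMB.posterior 𝕃 m b s z π)
        (GLMB.postWeightGLMB 𝕃 m b s z ω p) (fun q => p' q.2.1 q.2.2) ∧
      -- its density, written out
      GLMB.SetAEEq μ (GLMB.posterior 𝕃 m b s z π) (fun X =>
        GLMB.distinctLabel X * ∑' I : Finset Λ, ∑' ξ : Ξ,
          ∑ θ ∈ GLMB.extAssoc M (GLMB.jointLabels 𝔹 I),
            GLMB.postWeight 𝕃 m b s z ω p I ξ θ *
              GLMB.kron (GLMB.live M 𝔹 I θ) (GLMB.labels X) *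
              ∏ y ∈ X, p' ξ θ y.1 y.2) ∧
      -- the track densities are the updated ones wherever these are defined
      (∀ ξ θ, ∀ ℓ ∈ 𝕃 ∪ (𝔹 : Set Λ), θ ℓ < M + 1 →
        GLMB.etaZ 𝕃 m b s z p ξ θ ℓ ≠ 0 → GLMB.etaZ 𝕃 m b s z p ξ θ ℓ ≠ ∞ →
        ∀ x, p' ξ θ x ℓ = GLMB.postTrack 𝕃 m b s z p ξ θ x ℓ) ∧
      -- which is the case for every track of every component of non-zero weight
      (∀ I ξ, ∀ θ ∈ GLMB.extAssoc M (GLMB.jointLabels 𝔹 I),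
        GLMB.postWeight 𝕃 m b s z ω p I ξ θ ≠ 0 → ∀ ℓ ∈ GLMB.live M 𝔹 I θ,
        GLMB.etaZ 𝕃 m b s z p ξ θ ℓ ≠ 0 ∧ GLMB.etaZ 𝕃 m b s z p ξ θ ℓ ≠ ∞) := by
  have hdens := GLMB.posterior_aeEq h𝔹 hπ hN0 hN1
  have hN0' := hN0
  have hN1' := hN1
  rw [GLMB.evidence_eq h𝔹 hπ] at hN0' hN1'
  have hT0 := right_ne_zero_of_mul hN0'
  have hT1 : ∑' q, GLMB.rawCoeff 𝕃 m b s z ω p q ≠ ⊤ := fun h =>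
    hN1' (by rw [h, ENNReal.mul_top (left_ne_zero_of_mul hN0')])
  refine ⟨GLMB.completedTrack 𝕃 m b s z p, ⟨?_, ?_, ?_, ?_, ?_⟩, ?_, ?_, ?_⟩
  · rintro K ⟨I, ξ, θ⟩ hK
    rw [GLMB.postWeightGLMB]
    split_ifs with h
    · by_cases hω : ω I ξ = 0
      · simp [GLMB.postWeight, GLMB.rawWeight, hω]
      · refine absurd (fun ℓ hℓ => ?_) hK
        rw [h.2] at hℓ
        exact (GLMB.mem_jointLabels.1 (GLMB.live_subset hℓ)).imp (fun h' => hπ.subset hω h') id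
    · rfl
  · have h := GLMB.tsum_postWeightGLMB (𝕃 := 𝕃) (m := m) (b := b) (s := s) (z := z) (ω := ω)
      (p := p) fun _ _ => 1
    simp only [mul_one] at h
    rw [h]
    simp_rw [div_eq_mul_inv]
    rw [ENNReal.tsum_mul_right, ENNReal.mul_inv_cancel hT0 hT1]
  · exact fun q ℓ hℓ => GLMB.measurable_completedTrack hπ _ _ hℓ
  · exact fun q ℓ hℓ => GLMB.lintegral_completedTrack hπ _ _ hℓ
  · intro n l
    filter_upwards [hdens n l] with x hx hi
    rw [hx hi, ← GLMB.tsum_postWeightGLMB fun K q => GLMB.kron K (GLMB.labels (GLMB.stateSet x l)) *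
      ∏ y ∈ GLMB.stateSet x l, GLMB.completedTrack 𝕃 m b s z p q.2.1 q.2.2 y.1 y.2]
    simp_rw [mul_assoc]
  · intro n l
    filter_upwards [hdens n l] with x hx hi
    rw [hx hi, GLMB.tsum_components]
    simp_rw [← GLMB.postWeight_ite, ite_mul, zero_mul, mul_assoc]
  · intro ξ θ ℓ _ _ h0 h1 x
    rw [GLMB.completedTrack, if_pos ⟨h0, h1⟩]
  · intro I ξ θ hθ hw ℓ hℓ
    -- Each raw weight is a term of the finite total, hence finite.
    have hle := ENNReal.le_tsum (f := GLMB.rawCoeff 𝕃 m b s z ω p) (I, ξ, θ)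
    rw [GLMB.rawCoeff, if_pos hθ] at hle
    refine GLMB.etaZ_ne_of_rawWeight_ne hθ (fun h => hw ?_) (ne_top_of_le_ne_top hT1 hle) hℓ
    rw [GLMB.postWeight, h, ENNReal.zero_div]
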